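/- Let $\omega$ be the Fubini–Study form on $\mathbb{CP}^1$ normalized to have volume $1$, i.e. $\omega=\frac{\sqrt{-1}}{2\pi}\partial\bar\partial\log(1+|z|^2)$ in the standard affine charts, and let $\Delta\ge 0$ be the Laplace–Beltrami operator of the associated Riemannian metric; for $i\ge 0$ let $\mathcal W_i=\{f\in C^\infty(\mathbb{CP}^1,\mathbb R): \Delta f=4\pi i(i+1)f\}$ be its $i$-th eigenspace. Let $k\ge 1$. For a basis $s=(s_0,\dots,s_k)$ of $H^0(\mathbb{CP}^1,O(k))$ (homogeneous polynomials of degree $k$ in two variables) let $\iota_s:\mathbb{CP}^1\to\mathbb{CP}^k$, $x\mapsto[s_0(x):\dots:s_k(x)]$, and let $\mu([Z])=\big(Z_a\bar Z_b/|Z|^2\big)_{a,b}$ be the moment map on $\mathbb{CP}^k$. The embedding $\iota_s$ is called balanced if the trace-free part of $\int_{\mathbb{CP}^1}\mu(\iota_s(x))\,\omega$ vanishes. For a Hermitian $(k+1)\times(k+1)$ matrix $A$ let $H_A=\mathrm{tr}(A\,\mu\circ\iota_s)$ be its Hamiltonian on $\mathbb{CP}^1$, let $\xi_A([Z])=[Z,AZ]$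 be the induced vector field on $\mathbb{CP}^k$, and let $P_k(A)=\xi_A|_{\iota_s(\mathbb{CP}^1)}$, a section of $\iota_s^*T\mathbb{CP}^k$. Let $P_k^*$ be the adjoint of $P_k$ with respect to the inner product $\mathrm{tr}(AB)$ on Hermitian matrices and the $L^2$ inner product $\int_{\mathbb{CP}^1}\mathrm{Re}\langle\cdot,\cdot\rangle_{FS}\,\omega$ on sections, where $\langle[Z,X],[Z,Y]\rangle_{FS}=\frac{\langle X,Y\rangle}{|Z|^2}-\frac{\langle X,Z\rangle\langle Z,Y\rangle}{|Z|^4}$. Put $U_i=\{A \text{ Hermitian}: H_A\in\mathcal W_i\}$. For every $k\ge1$ the basis $\sqrt{\binom kj}\,Z_0^jZ_1^{k-j}$, $0\le j\le k$, defines a balanced embedding. Moreover, for every $i\ge 0$ there are a constant $K_i$, depending only on $i$, and real numbers $c_{i,k}$ $(k\ge1)$ with $$\Big|c_{i,k}-\frac{4\pi i(i+1)}{4\pi k^2}\Big|\le \frac{K_i}{k^3}$$ such that for every $k\ge1$ and every balanced embedding of $\mathbb{CP}^1$ into $\mathbb{CP}^k$ given by a basis of $H^0(\mathbb{CP}^1,O(k))$,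 $$\mathrm{tr}\big(A\,P_k^*P_k(B)\big)=c_{i,k}\,\mathrm{tr}(AB)\qquad\text{for all }A,B\in U_i,$$ and $P_k^*P_k(B)=c_{i,k}B$ for all $B\in U_i$. In other words, $\mathrm{tr}(A\,P_k^*P_k(B))=\big(\frac{i(i+1)}{k^2}+O(k^{-3})\big)\mathrm{tr}(AB)$ on $U_i$, and $P_k^*P_k$ restricted to $U_i$ is a scalar, asymptotic to $\frac{4\pi i(i+1)}{4\pi k^2}$. -/

import Mathlib

open scoped ContDiff InnerProductSpace LinearAlgebra.Projectivization
open MeasureTheory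

noncomputable section

namespace BalancedP1

/-! ### Projective space, the moment map and the Fubini-Study metric -/

/-- Complex projective space `ℂPⁿ` (lines in `ℂⁿ⁺¹`). -/
abbrev CP (n : ℕ) : Type := ℙ ℂ (EuclideanSpace ℂ (Fin (n + 1)))

/-- The Hermitian matrices of size `k + 1`, i.e. `√-1 𝔲(k+1)`. -/
abbrev Herm (k : ℕ) : Type := selfAdjoint (Matrix (Fin (k + 1)) (Fin (k + 1)) ℂ)

/-- The moment map `μ([Z]) = (Z_a conj(Z_b) / |Z|²)` of the unitary group acting on `ℂPᵏ`. -/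
def momentMap {k : ℕ} (p : CP k) : Matrix (Fin (k + 1)) (Fin (k + 1)) ℂ :=
  Matrix.of fun a b => p.rep a * star (p.rep b) / ((‖p.rep‖ ^ 2 : ℝ) : ℂ)

/-- The holomorphic tangent space of `ℂPᵏ` at a line `p` is `Hom(p, ℂᵏ⁺¹ / p)`; the quotient is
identified with the orthogonal complement of `p`. The pair `[z, X]`, with `X` a tangent
direction at the representative `z`, is the homomorphism sending `z` to the component of `X`
orthogonal to `z`. -/
abbrev TangentCP {k : ℕ} (p : CP k) : Type :=
  p.submodule →ₗ[ℂ] ↥(p.submoduleᗮ)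

/-- The chosen representative of a line, as an element of that line. -/
def lineRep {k : ℕ} (p : CP k) : p.submodule :=
  ⟨p.rep, by rw [Projectivization.submodule_eq]; exact Submodule.mem_span_singleton_self _⟩

/-- The Fubini-Study Riemannian metric on `ℂPᵏ`: for `φ = [z, X]` and `ψ = [z, Y]` it is the
real part of `⟨X, Y⟩ / |z|² - ⟨X, z⟩ ⟨z, Y⟩ / |z|⁴`. -/
def fsMetric {k : ℕ} (p : CP k) (φ ψ : TangentCP p) : ℝ :=
  (⟪φ (lineRep p), ψ (lineRep p)⟫_ℂ).re / ‖p.rep‖ ^ 2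

/-- The holomorphic vector field `ξ_A([z]) = [z, A z]` on `ℂPᵏ`. -/
def vectorField {k : ℕ} (A : Matrix (Fin (k + 1)) (Fin (k + 1)) ℂ) (p : CP k) : TangentCP p :=
  (p.submoduleᗮ).orthogonalProjectionOnto.toLinearMap ∘ₗ Matrix.toEuclideanLin A ∘ₗ
    p.submodule.subtype

/-! ### The Fubini-Study geometry of the projective line -/

/-- The vectors `(1, z)` (for `j = 0`) and `(z, 1)` (for `j = 1`). -/
def chartVec (j : Fin 2) (z : ℂ) : EuclideanSpace ℂ (Fin (1 + 1)) :=
  WithLp.toLp 2 fun i => if i = j then 1 else z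

lemma chartVec_ne_zero (j : Fin 2) (z : ℂ) : chartVec j z ≠ 0 := by
  intro h
  have := congrArg (fun v : EuclideanSpace ℂ (Fin (1 + 1)) => v j) h
  simp [chartVec] at this

/-- The two standard holomorphic charts `z ↦ [1 : z]` and `z ↦ [z : 1]` of `ℂP¹`. -/
def chart (j : Fin 2) (z : ℂ) : CP 1 :=
  Projectivization.mk ℂ (chartVec j z) (chartVec_ne_zero j z)

/-- The density of the Fubini-Study form of `ℂP¹`: in either standard chart
`ω_FS = (√-1/2π) ∂∂̄ log (1 + |z|²) = fsDensity z dx ∧ dy`, so that `ℂP¹` has volume `1`,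
and the corresponding Riemannian metric is `fsDensity z (dx² + dy²)`. -/
def fsDensity (z : ℂ) : ℝ := 1 / (Real.pi * (1 + ‖z‖ ^ 2) ^ 2)

/-- The integral `∫_{ℂP¹} f ω_FS`, computed in the chart `z ↦ [1 : z]`, which omits one point. -/
def fsIntegral {E : Type*} [NormedAddCommGroup E] [NormedSpace ℝ E] (f : CP 1 → E) : E :=
  ∫ z : ℂ, fsDensity z • f (chart 0 z)

/-- Smooth real functions on `ℂP¹`. -/
def IsSmooth (f : CP 1 → ℝ) : Prop := ∀ j : Fin 2, ContDiff ℝ ∞ fun z : ℂ => f (chart j z)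

/-- The (nonnegative) Laplace-Beltrami operator `-(1/fsDensity) (∂²/∂x² + ∂²/∂y²)` of the
Fubini-Study metric of `ℂP¹`, written in the `j`-th chart. -/
def fsLaplacian (f : CP 1 → ℝ) (j : Fin 2) (z : ℂ) : ℝ :=
  -(1 / fsDensity z) * Laplacian.laplacian (fun w : ℂ => f (chart j w)) z

/-- The `i`-th eigenvalue `4π i (i + 1)` of the Fubini-Study Laplacian of `ℂP¹`. -/
def eigenvalue (i : ℕ) : ℝ := 4 * Real.pi * i * (i + 1)

/-- The `i`-th eigenspace `𝒲_i` of the Laplacian on smooth real functions on `ℂP¹`. -/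
def eigenspace (i : ℕ) : Set (CP 1 → ℝ) :=
  {f | IsSmooth f ∧ ∀ (j : Fin 2) (z : ℂ), fsLaplacian f j z = eigenvalue i * f (chart j z)}

/-! ### Embeddings by sections of `O(k)` -/

/-- Bases of `H⁰(ℂP¹, O(k))`, the space of homogeneous polynomials of degree `k` in two
variables. -/
abbrev SectionBasis (k : ℕ) : Type :=
  Module.Basis (Fin (k + 1)) ℂ (MvPolynomial.homogeneousSubmodule (Fin 2) ℂ k)

/-- The values at `Z ∈ ℂ²` of the sections of a basis. -/
def sectionVec {k : ℕ} (s : SectionBasis k) (Z : EuclideanSpace ℂ (Fin (1 + 1))) :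
    EuclideanSpace ℂ (Fin (k + 1)) :=
  WithLp.toLp 2 fun j => MvPolynomial.eval (fun i : Fin 2 => Z i) (s j : MvPolynomial (Fin 2) ℂ)

lemma sectionVec_ne_zero {k : ℕ} (s : SectionBasis k) {Z : EuclideanSpace ℂ (Fin (1 + 1))}
    (hZ : Z ≠ 0) : sectionVec s Z ≠ 0 := by
  intro h
  apply hZ
  have key : ∀ q : MvPolynomial.homogeneousSubmodule (Fin 2) ℂ k,
      MvPolynomial.eval (fun i : Fin 2 => Z i) (q : MvPolynomial (Fin 2) ℂ) = 0 := by
    intro q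
    rw [← s.sum_repr q]
    simp only [Submodule.coe_sum, Submodule.coe_smul, map_sum, MvPolynomial.smul_eval]
    refine Finset.sum_eq_zero fun j _ => ?_
    have := congrArg (fun v : EuclideanSpace ℂ (Fin (k + 1)) => v j) h
    simp only [sectionVec, PiLp.zero_apply] at this
    rw [this, mul_zero]
  ext i
  have := key ⟨MvPolynomial.X i ^ k, by
    simpa using (MvPolynomial.isHomogeneous_X ℂ i).pow k⟩
  simp only [map_pow, MvPolynomial.eval_X] at this
  exact eq_zero_of_pow_eq_zero this

/-- The map `ι_s : ℂP¹ → ℂPᵏ`, `[Z] ↦ [s_0(Z) : ⋯ : s_k(Z)]`, given by a basis of sections. -/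
def embedding {k : ℕ} (s : SectionBasis k) (x : CP 1) : CP k :=
  Projectivization.mk ℂ (sectionVec s x.rep) (sectionVec_ne_zero s x.rep_nonzero)

/-- `μ̄ = ∫_{ℂP¹} μ(ι_s(x)) ω_FS(x)`. -/
def meanMoment {k : ℕ} (s : SectionBasis k) : Matrix (Fin (k + 1)) (Fin (k + 1)) ℂ :=
  Matrix.of fun a b => fsIntegral fun x => momentMap (embedding s x) a b

/-- The embedding given by `s` is balanced: the trace-free part of `μ̄` vanishes. -/
def IsBalanced {k : ℕ} (s : SectionBasis k) : Prop :=
  meanMoment s - ((meanMoment s).trace / ((k : ℂ) + 1)) • 1 = 0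

/-- The Hamiltonian `H_A = tr(A μ)`, restricted to `ℂP¹` by the embedding. It is real valued
for Hermitian `A`. -/
def hamiltonian {k : ℕ} (s : SectionBasis k) (A : Herm k) (x : CP 1) : ℝ :=
  ((A : Matrix (Fin (k + 1)) (Fin (k + 1)) ℂ) * momentMap (embedding s x)).trace.re

/-- `U_i`: the Hermitian matrices whose Hamiltonian lies in the `i`-th eigenspace of the
Laplacian. -/
def U {k : ℕ} (s : SectionBasis k) (i : ℕ) : Set (Herm k) :=
  {A | hamiltonian s A ∈ eigenspace i}

/-! ### The operators `P` and `P*` -/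

/-- Sections over `ℂP¹` of the restriction of the tangent bundle of `ℂPᵏ`. -/
abbrev TangentSection {k : ℕ} (s : SectionBasis k) : Type :=
  (x : CP 1) → TangentCP (embedding s x)

/-- `P(A) = ξ_A` restricted to `ℂP¹`. -/
def opP {k : ℕ} (s : SectionBasis k) (A : Herm k) : TangentSection s :=
  fun x => vectorField (A : Matrix (Fin (k + 1)) (Fin (k + 1)) ℂ) (embedding s x)

/-- The `L²` inner product of sections, for the Fubini-Study metric on the tangent space of
`ℂPᵏ` and the volume form `ω_FS` of `ℂP¹`. -/
def l2Inner {k : ℕ} (s : SectionBasis k) (σ τ : TangentSection s) : ℝ :=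
  fsIntegral fun x => fsMetric (embedding s x) (σ x) (τ x)

open scoped Classical in
/-- The adjoint of `P` for the inner product `tr(A B)` on Hermitian matrices and the `L²` inner
product on sections: `P*(σ)` is the (unique) Hermitian matrix `C` such that
`tr(A C) = ⟨P(A), σ⟩` for all Hermitian `A`. -/
def opPStar {k : ℕ} (s : SectionBasis k) (σ : TangentSection s) : Herm k :=
  if h : ∃ C : Herm k, ∀ A : Herm k,
      ((A : Matrix (Fin (k + 1)) (Fin (k + 1)) ℂ) * (C : Matrix _ _ ℂ)).trace
        = ((l2Inner s (opP s A) σ : ℝ) : ℂ)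
  then h.choose else 0

/-- The operator `P*P` on Hermitian matrices. -/
def opPStarP {k : ℕ} (s : SectionBasis k) (B : Herm k) : Herm k := opPStar s (opP s B)

/-! ### The definitions do not depend on choices, and the adjoint exists -/

lemma momentMap_mk {k : ℕ} (v : EuclideanSpace ℂ (Fin (k + 1))) (hv : v ≠ 0) :
    momentMap (Projectivization.mk ℂ v hv) =
      Matrix.of fun a b => v a * star (v b) / ((‖v‖ ^ 2 : ℝ) : ℂ) := by
  obtain ⟨t, ht⟩ := Projectivization.exists_smul_eq_mk_rep ℂ v hv
  ext a b
  have h0 : (t : ℂ) ≠ 0 := t.ne_zero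
  have hn : ((‖v‖ : ℝ) : ℂ) ≠ 0 := by simpa using hv
  have ht' : (Projectivization.mk ℂ v hv).rep = (t : ℂ) • v := ht.symm
  have h2 : (star (t : ℂ)) * t = ((‖(t : ℂ)‖ ^ 2 : ℝ) : ℂ) := by
    simpa using Complex.conj_mul' (t : ℂ)
  have h3 : ((‖(t : ℂ)‖ : ℝ) : ℂ) ≠ 0 := by simpa using h0
  simp only [momentMap, Matrix.of_apply, ht', PiLp.smul_apply, smul_eq_mul, norm_smul, star_mul']
  have : (t : ℂ) * v a * (star (t : ℂ) * star (v b)) =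
      ((‖(t : ℂ)‖ ^ 2 : ℝ) : ℂ) * (v a * star (v b)) := by rw [← h2]; ring
  rw [this]
  push_cast
  field_simp

lemma embedding_mk {k : ℕ} (s : SectionBasis k) (Z : EuclideanSpace ℂ (Fin (1 + 1)))
    (hZ : Z ≠ 0) : embedding s (Projectivization.mk ℂ Z hZ) =
      Projectivization.mk ℂ (sectionVec s Z) (sectionVec_ne_zero s hZ) := by
  obtain ⟨t, ht⟩ := Projectivization.exists_smul_eq_mk_rep ℂ Z hZ
  have ht' : (Projectivization.mk ℂ Z hZ).rep = (t : ℂ) • Z := ht.symm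
  rw [embedding, Projectivization.mk_eq_mk_iff']
  refine ⟨(t : ℂ) ^ k, ?_⟩
  ext j
  have hq : (s j : MvPolynomial (Fin 2) ℂ).IsHomogeneous k := (s j).2
  simp only [sectionVec, ht', PiLp.smul_apply, smul_eq_mul]
  rw [MvPolynomial.eval_eq, MvPolynomial.eval_eq, Finset.mul_sum]
  refine Finset.sum_congr rfl fun d hd => ?_
  have hdk : ∑ i ∈ d.support, d i = k := by
    have := hq (MvPolynomial.mem_support_iff.1 hd)
    simpa [Finsupp.weight_apply, Finsupp.sum] using this
  simp only [mul_pow, Finset.prod_mul_distrib]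
  rw [Finset.prod_pow_eq_pow_sum, hdk]
  ring

lemma trace_mul_momentMap {k : ℕ} (M : Matrix (Fin (k + 1)) (Fin (k + 1)) ℂ) (p : CP k) :
    (M * momentMap p).trace =
      ⟪p.rep, Matrix.toEuclideanLin M p.rep⟫_ℂ / ((‖p.rep‖ ^ 2 : ℝ) : ℂ) := by
  simp only [Matrix.trace, Matrix.diag, Matrix.mul_apply, momentMap, Matrix.of_apply,
    PiLp.inner_apply, Matrix.toLpLin_apply, Matrix.mulVec, dotProduct, RCLike.inner_apply]
  rw [Finset.sum_div]
  refine Finset.sum_congr rfl fun a _ => ?_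
  rw [Finset.sum_mul, Finset.sum_div]
  refine Finset.sum_congr rfl fun b _ => ?_
  simp
  ring

lemma inner_toEuclideanLin {k : ℕ} (A : Herm k) (v w : EuclideanSpace ℂ (Fin (k + 1))) :
    ⟪Matrix.toEuclideanLin (A : Matrix (Fin (k + 1)) (Fin (k + 1)) ℂ) v, w⟫_ℂ =
      ⟪v, Matrix.toEuclideanLin (A : Matrix (Fin (k + 1)) (Fin (k + 1)) ℂ) w⟫_ℂ := by
  have hA : Matrix.IsHermitian (A : Matrix (Fin (k + 1)) (Fin (k + 1)) ℂ) := A.2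
  exact (Matrix.isSymmetric_toEuclideanLin_iff.2 hA) v w

lemma fsMetric_vectorField {k : ℕ} (A B : Herm k) (p : CP k) :
    fsMetric p (vectorField (A : Matrix (Fin (k + 1)) (Fin (k + 1)) ℂ) p)
        (vectorField (B : Matrix (Fin (k + 1)) (Fin (k + 1)) ℂ) p) =
      (((A : Matrix (Fin (k + 1)) (Fin (k + 1)) ℂ) * (B : Matrix _ _ ℂ) * momentMap p).trace
        - ((A : Matrix (Fin (k + 1)) (Fin (k + 1)) ℂ) * momentMap p).trace *
          ((B : Matrix (Fin (k + 1)) (Fin (k + 1)) ℂ) * momentMap p).trace).re := by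
  have hn : ((‖p.rep‖ : ℝ) : ℂ) ≠ 0 := by simpa using p.rep_nonzero
  set v := p.rep with hv
  set a := Matrix.toEuclideanLin (A : Matrix (Fin (k + 1)) (Fin (k + 1)) ℂ) v with ha
  set b := Matrix.toEuclideanLin (B : Matrix (Fin (k + 1)) (Fin (k + 1)) ℂ) v with hb
  have h1 : ⟪vectorField (A : Matrix (Fin (k + 1)) (Fin (k + 1)) ℂ) p (lineRep p),
      vectorField (B : Matrix (Fin (k + 1)) (Fin (k + 1)) ℂ) p (lineRep p)⟫_ℂ =
      ⟪a, b⟫_ℂ - ⟪a, v⟫_ℂ * ⟪v, b⟫_ℂ / ((‖v‖ ^ 2 : ℝ) : ℂ) := by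
    have : ⟪vectorField (A : Matrix (Fin (k + 1)) (Fin (k + 1)) ℂ) p (lineRep p),
        vectorField (B : Matrix (Fin (k + 1)) (Fin (k + 1)) ℂ) p (lineRep p)⟫_ℂ =
        ⟪(p.submoduleᗮ).starProjection a, (p.submoduleᗮ).starProjection b⟫_ℂ := rfl
    rw [this, Submodule.inner_starProjection_left_eq_right,
      Submodule.starProjection_eq_self_iff.2 (Submodule.starProjection_apply_mem _ _),
      Submodule.starProjection_orthogonal_val]
    simp only [Projectivization.submodule_eq, Submodule.starProjection_singleton, ← hv]
    rw [inner_sub_right, inner_smul_right]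
    simp only [Complex.coe_algebraMap, RCLike.ofReal_pow, Complex.ofReal_pow]
    push_cast
    ring_nf
    try rfl
  rw [fsMetric, h1]
  have e1 := trace_mul_momentMap (A : Matrix (Fin (k + 1)) (Fin (k + 1)) ℂ) p
  have e2 := trace_mul_momentMap (B : Matrix (Fin (k + 1)) (Fin (k + 1)) ℂ) p
  have e3 := trace_mul_momentMap
    ((A : Matrix (Fin (k + 1)) (Fin (k + 1)) ℂ) * (B : Matrix (Fin (k + 1)) (Fin (k + 1)) ℂ)) p
  have e4 : Matrix.toEuclideanLin
      ((A : Matrix (Fin (k + 1)) (Fin (k + 1)) ℂ) * (B : Matrix (Fin (k + 1)) (Fin (k + 1)) ℂ)) v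
      = Matrix.toEuclideanLin (A : Matrix (Fin (k + 1)) (Fin (k + 1)) ℂ) b := by
    simp [hb, Matrix.toLpLin_apply, Matrix.mulVec_mulVec]
  have e5 : ⟪v, Matrix.toEuclideanLin (A : Matrix (Fin (k + 1)) (Fin (k + 1)) ℂ) b⟫_ℂ = ⟪a, b⟫_ℂ :=
    (inner_toEuclideanLin A v b).symm
  have e6 : ⟪v, a⟫_ℂ = ⟪a, v⟫_ℂ := (inner_toEuclideanLin A v v).symm
  rw [e1, e2, e3, ← hv, e4, e5, ← ha, ← hb, e6, ← Complex.div_ofReal_re]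
  congr 1
  push_cast
  field_simp

lemma continuous_sectionVec_chartVec {k : ℕ} (s : SectionBasis k) (j : Fin 2) :
    Continuous fun z : ℂ => sectionVec s (chartVec j z) := by
  refine (PiLp.continuous_toLp 2 _).comp (continuous_pi fun l => ?_)
  refine (MvPolynomial.continuous_eval _).comp (continuous_pi fun i => ?_)
  by_cases h : i = j <;> simp [chartVec, h, continuous_const, continuous_id']

lemma continuous_momentMap_chart {k : ℕ} (s : SectionBasis k) (j : Fin 2) :
    Continuous fun z : ℂ => momentMap (embedding s (chart j z)) := by
  have h : ∀ z, momentMap (embedding s (chart j z)) = _ := fun z => by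
    rw [chart, embedding_mk, momentMap_mk]
  simp only [h]
  have hc := continuous_sectionVec_chartVec s j
  refine continuous_matrix fun a b => ?_
  simp only [Matrix.of_apply]
  refine Continuous.div ?_ ?_ fun z => ?_
  · exact ((EuclideanSpace.proj a).continuous.comp hc).mul
      ((EuclideanSpace.proj b).continuous.comp hc).star
  · exact Complex.continuous_ofReal.comp (hc.norm.pow 2)
  · simpa using sectionVec_ne_zero s (chartVec_ne_zero j z)

lemma integrable_fsDensity : Integrable fsDensity := by
  have h := integrable_rpow_neg_one_add_norm_sq (E := ℂ) (μ := volume) (r := 4)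
    (by rw [Complex.finrank_real_complex]; norm_num)
  refine (h.const_mul (1 / Real.pi)).congr (Filter.Eventually.of_forall fun z => ?_)
  have : (0 : ℝ) < 1 + ‖z‖ ^ 2 := by positivity
  have e : (-4 / 2 : ℝ) = -(2 : ℕ) := by norm_num
  simp only [fsDensity]
  rw [e, Real.rpow_neg this.le, Real.rpow_natCast]
  field_simp

lemma abs_fsMetric_le {k : ℕ} (A B : Matrix (Fin (k + 1)) (Fin (k + 1)) ℂ) (p : CP k) :
    |fsMetric p (vectorField A p) (vectorField B p)| ≤
      ‖(Matrix.toEuclideanLin A).toContinuousLinearMap‖ *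
        ‖(Matrix.toEuclideanLin B).toContinuousLinearMap‖ := by
  have hn : 0 < ‖p.rep‖ := norm_pos_iff.2 p.rep_nonzero
  have key : ∀ M : Matrix (Fin (k + 1)) (Fin (k + 1)) ℂ, ‖vectorField M p (lineRep p)‖ ≤
      ‖(Matrix.toEuclideanLin M).toContinuousLinearMap‖ * ‖p.rep‖ := fun M =>
    ((p.submoduleᗮ).norm_orthogonalProjectionOnto_apply_le (Matrix.toEuclideanLin M p.rep)).trans
      ((Matrix.toEuclideanLin M).toContinuousLinearMap.le_opNorm p.rep)
  rw [fsMetric, abs_div, abs_of_pos (pow_pos hn 2), div_le_iff₀ (pow_pos hn 2)]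
  calc _ ≤ ‖vectorField A p (lineRep p)‖ * ‖vectorField B p (lineRep p)‖ :=
        (Complex.abs_re_le_norm _).trans (norm_inner_le_norm _ _)
    _ ≤ _ := mul_le_mul (key A) (key B) (norm_nonneg _) (by positivity)
    _ = _ := by ring

lemma integrable_l2Inner {k : ℕ} (s : SectionBasis k) (A B : Herm k) :
    Integrable fun z : ℂ => fsDensity z •
      fsMetric (embedding s (chart 0 z)) (opP s A (chart 0 z)) (opP s B (chart 0 z)) := by
  refine integrable_fsDensity.mul_bdd (c :=
      ‖(Matrix.toEuclideanLin (A : Matrix (Fin (k + 1)) (Fin (k + 1)) ℂ)).toContinuousLinearMap‖ *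
        ‖(Matrix.toEuclideanLin (B : Matrix (Fin (k + 1)) (Fin (k + 1)) ℂ)).toContinuousLinearMap‖)
    ?_ (Filter.Eventually.of_forall fun z => abs_fsMetric_le _ _ _)
  refine Continuous.aestronglyMeasurable ?_
  have hc := continuous_momentMap_chart s 0
  simp only [opP, fsMetric_vectorField]
  have ht : ∀ M : Matrix (Fin (k + 1)) (Fin (k + 1)) ℂ,
      Continuous fun z : ℂ => (M * momentMap (embedding s (chart 0 z))).trace :=
    fun M => (continuous_const.matrix_mul hc).matrix_trace
  exact Complex.continuous_re.comp ((ht _).sub ((ht _).mul (ht _)))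

open scoped ComplexOrder in
lemma trace_conjTranspose_mul_self_eq_zero' {k : ℕ} {M : Matrix (Fin (k + 1)) (Fin (k + 1)) ℂ} :
    (M.conjTranspose * M).trace = 0 ↔ M = 0 :=
  Matrix.trace_conjTranspose_mul_self_eq_zero_iff

/-- Nondegeneracy of the trace form. -/
lemma herm_ext {k : ℕ} {C D : Herm k}
    (h : ∀ A : Herm k, ((A : Matrix (Fin (k + 1)) (Fin (k + 1)) ℂ) * (C : Matrix _ _ ℂ)).trace =
      ((A : Matrix (Fin (k + 1)) (Fin (k + 1)) ℂ) * (D : Matrix _ _ ℂ)).trace) : C = D := by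
  have h1 := h (C - D)
  rw [← sub_eq_zero, ← Matrix.trace_sub, ← Matrix.mul_sub, ← AddSubgroup.coe_sub] at h1
  have hs : Matrix.conjTranspose ((C - D : Herm k) : Matrix (Fin (k + 1)) (Fin (k + 1)) ℂ) =
      ((C - D : Herm k) : Matrix (Fin (k + 1)) (Fin (k + 1)) ℂ) := (C - D).2
  rw [← hs, hs] at h1
  nth_rewrite 1 [← hs] at h1
  rw [trace_conjTranspose_mul_self_eq_zero'] at h1
  exact sub_eq_zero.1 (Subtype.ext h1)

lemma trace_herm_mul_re {k : ℕ} (A C : Herm k) :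
    ((((A : Matrix (Fin (k + 1)) (Fin (k + 1)) ℂ) * (C : Matrix _ _ ℂ)).trace.re : ℝ) : ℂ) =
      ((A : Matrix (Fin (k + 1)) (Fin (k + 1)) ℂ) * (C : Matrix _ _ ℂ)).trace := by
  have hA : Matrix.conjTranspose (A : Matrix (Fin (k + 1)) (Fin (k + 1)) ℂ) = A := A.2
  have hC : Matrix.conjTranspose (C : Matrix (Fin (k + 1)) (Fin (k + 1)) ℂ) = C := C.2
  rw [← Complex.conj_eq_iff_re]
  change star _ = _
  rw [← Matrix.trace_conjTranspose, Matrix.conjTranspose_mul, hA, hC, Matrix.trace_mul_comm]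

instance instFiniteHerm (k : ℕ) : FiniteDimensional ℝ (Herm k) :=
  inferInstanceAs (FiniteDimensional ℝ
    (selfAdjoint.submodule ℝ (Matrix (Fin (k + 1)) (Fin (k + 1)) ℂ)))

/-- Riesz representation for the trace form. -/
lemma exists_trace_eq {k : ℕ} (l : Herm k →ₗ[ℝ] ℝ) : ∃ C : Herm k, ∀ A : Herm k,
    ((A : Matrix (Fin (k + 1)) (Fin (k + 1)) ℂ) * (C : Matrix _ _ ℂ)).trace = ((l A : ℝ) : ℂ) := by
  let T : Herm k →ₗ[ℝ] Module.Dual ℝ (Herm k) := LinearMap.mk₂ ℝ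
    (fun C A : Herm k =>
      ((A : Matrix (Fin (k + 1)) (Fin (k + 1)) ℂ) * (C : Matrix _ _ ℂ)).trace.re)
    (by intros; simp [Matrix.mul_add]) (by intros; simp)
    (by intros; simp [Matrix.add_mul]) (by intros; simp)
  have hinj : Function.Injective T := by
    intro C D h
    refine herm_ext fun A => ?_
    rw [← trace_herm_mul_re A C, ← trace_herm_mul_re A D]
    exact congrArg (fun r : ℝ => (r : ℂ)) (LinearMap.congr_fun h A)
  obtain ⟨C, hC⟩ := (LinearMap.injective_iff_surjective_of_finrank_eq_finrank
    (Subspace.dual_finrank_eq).symm).1 hinj l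
  refine ⟨C, fun A => ?_⟩
  rw [← trace_herm_mul_re, ← hC]
  rfl

/-- The defining property of `P*P`: `tr(A P*P(B)) = ⟨P(A), P(B)⟩` for all Hermitian `A`, `B`. -/
theorem trace_mul_opPStarP {k : ℕ} (s : SectionBasis k) (A B : Herm k) :
    ((A : Matrix (Fin (k + 1)) (Fin (k + 1)) ℂ) * (opPStarP s B : Matrix _ _ ℂ)).trace =
      ((l2Inner s (opP s A) (opP s B) : ℝ) : ℂ) := by
  have hadd : ∀ A A' : Herm k, l2Inner s (opP s (A + A')) (opP s B) =
      l2Inner s (opP s A) (opP s B) + l2Inner s (opP s A') (opP s B) := by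
    intro A A'
    rw [l2Inner, l2Inner, l2Inner, fsIntegral, fsIntegral, fsIntegral,
      ← integral_add (integrable_l2Inner s A B) (integrable_l2Inner s A' B)]
    congr 1
    ext z
    simp only [opP]
    rw [fsMetric_vectorField, fsMetric_vectorField, fsMetric_vectorField]
    simp only [smul_eq_mul, AddSubgroup.coe_add, Matrix.add_mul,
      Matrix.trace_add, Complex.sub_re, Complex.add_re, add_mul]
    ring
  have hsmul : ∀ (t : ℝ) (A : Herm k), l2Inner s (opP s (t • A)) (opP s B) =
      t • l2Inner s (opP s A) (opP s B) := by
    intro t A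
    rw [l2Inner, l2Inner, fsIntegral, fsIntegral, ← integral_smul]
    congr 1
    ext z
    simp only [opP]
    rw [fsMetric_vectorField, fsMetric_vectorField]
    simp only [smul_eq_mul, selfAdjoint.val_smul, Matrix.smul_mul,
      Matrix.trace_smul, Complex.sub_re, Complex.smul_re, smul_mul_assoc]
    ring
  let l : Herm k →ₗ[ℝ] ℝ :=
    { toFun := fun A => l2Inner s (opP s A) (opP s B), map_add' := hadd, map_smul' := hsmul }
  have h := exists_trace_eq l
  have h' : ∃ C : Herm k, ∀ A : Herm k,
      ((A : Matrix (Fin (k + 1)) (Fin (k + 1)) ℂ) * (C : Matrix _ _ ℂ)).trace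
        = ((l2Inner s (opP s A) (opP s B) : ℝ) : ℂ) := h
  rw [opPStarP, opPStar, dif_pos h']
  exact h'.choose_spec A

end BalancedP1

end

/-!
All balanced embeddings of degree `k` are unitarily equivalent to the one given by the binomial basis
(`IsBalanced.transition_unitary`, an equality case of the Cauchy-Schwarz inequality). Consequently
`∫ μ ω = 1 / (k + 1)`, and the kernel `tr (μ(x) μ(y))` is the `k`-th power of the transition
probability `|⟨X, Y⟩|² / (|X|² |Y|²)`, whatever the balanced basis is.

The Fubini-Study metric satisfies `⟨ξ_A, ξ_B⟩ = Re (tr (A B μ) - tr (A μ) tr (B μ))`, so that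
`tr (A P*P(B)) = Re tr (A B) / (k + 1) - Re tr (A ∫ H_B μ ω)`. The Hamiltonian of the matrix
`∫ H_B μ ω` at `x` is `∫ H_B(y) tr (μ(x) μ(y)) ω(y)`. If `H_B` lies in the `i`-th eigenspace of the
Laplacian, this zonal integral is a multiple `funkHecke k i` of `H_B(x)`, by a Funk-Hecke formula
(`IsFormQuotient.integral_overlap`): averaging `H_B` over the rotations fixing `x` leaves a polynomial
in the height above `x`, which the eigenvalue equation turns into a solution of Legendre's equation
that is regular at `x`, and such a solution is determined by its value at `x`. As a matrix is
determined by its Hamiltonian, `∫ H_B μ ω = funkHecke k i • B`, and `P*P(B) = c • B` with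
`c = 1 / (k + 1) - funkHecke k i`. Expanding the Legendre polynomial in powers of the height writes
`funkHecke k i` as a finite sum of beta integrals, of which the first two give
`c = i (i + 1) / k² + O(k⁻³)`.
-/

noncomputable section

namespace BalancedP1

open scoped ContDiff InnerProductSpace LinearAlgebra.Projectivization
open MeasureTheory Laplacian Topology

/-! ### The Laplacian of the complex plane -/

lemma laplacian_of_hasFDerivAt {f : ℂ → ℝ} {f' : ℂ → ℂ →L[ℝ] ℝ} {f'' : ℂ →L[ℝ] ℂ →L[ℝ] ℝ} {z : ℂ}
    (h1 : ∀ᶠ u in 𝓝 z, HasFDerivAt f (f' u) u) (h2 : HasFDerivAt f' f'' z) :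
    Δ f z = f'' 1 1 + f'' Complex.I Complex.I := by
  have h3 : fderiv ℝ (fderiv ℝ f) z = f'' := by
    have : fderiv ℝ f =ᶠ[𝓝 z] f' := h1.mono fun u hu => hu.fderiv
    rw [this.fderiv_eq, h2.fderiv]
  simp [InnerProductSpace.laplacian_eq_iteratedFDeriv_complexPlane, iteratedFDeriv_two_apply, h3]

/-- Conformal covariance of the Laplacian. The terms with `ψ''` cancel because `1² + I² = 0`. -/
lemma laplacian_comp_holomorphic {f : ℂ → ℝ} (hf : ContDiff ℝ 2 f) {ψ ψ' : ℂ → ℂ} {c z : ℂ}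
    (h1 : ∀ᶠ u in 𝓝 z, HasDerivAt ψ (ψ' u) u) (h2 : HasDerivAt ψ' c z) :
    Δ (fun u => f (ψ u)) z = ‖ψ' z‖ ^ 2 * Δ f (ψ z) := by
  let T : ℂ →L[ℝ] ℂ →L[ℝ] ℂ := ContinuousLinearMap.mul ℝ ℂ
  have hd : ∀ u, HasFDerivAt f (fderiv ℝ f u) u := fun u =>
    (hf.differentiable (by norm_num) u).hasFDerivAt
  have hd2 : HasFDerivAt (fderiv ℝ f) (fderiv ℝ (fderiv ℝ f) (ψ z)) (ψ z) :=
    ((hf.fderiv_right (m := 1) (by norm_num)).differentiable (by norm_num) _).hasFDerivAt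
  have key : ∀ {φ : ℂ → ℂ} {d u : ℂ}, HasDerivAt φ d u → HasFDerivAt φ (T d) u := by
    intro φ d u h
    have := h.hasFDerivAt.restrictScalars ℝ
    refine this.congr_fderiv ?_
    ext x
    simp [T, mul_comm]
  have hz := key h1.self_of_nhds
  have e1 : ∀ᶠ u in 𝓝 z, HasFDerivAt (fun u => f (ψ u))
      ((fderiv ℝ f (ψ u)).comp (T (ψ' u))) u :=
    h1.mono fun u hu => (hd (ψ u)).comp u (key hu)
  have e2 := (hd2.comp z hz).clm_comp (T.hasFDerivAt.comp z (key h2))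
  rw [laplacian_of_hasFDerivAt e1 e2, laplacian_of_hasFDerivAt (Filter.Eventually.of_forall hd) hd2]
  set D := fderiv ℝ (fderiv ℝ f) (ψ z) with hD
  set D1 := fderiv ℝ f (ψ z)
  have hb : ∀ x y : ℂ, D x y = x.re * (y.re * D 1 1 + y.im * D 1 Complex.I)
      + x.im * (y.re * D Complex.I 1 + y.im * D Complex.I Complex.I) := by
    intro x y
    have hx : x = x.re • (1 : ℂ) + x.im • Complex.I := by
      simp [Complex.re_add_im]
    have hy : y = y.re • (1 : ℂ) + y.im • Complex.I := by
      simp [Complex.re_add_im]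
    conv_lhs => rw [hx, hy]
    simp only [map_add, map_smul, add_apply, smul_apply, smul_eq_mul]
    ring
  have hn : ‖ψ' z‖ ^ 2 = (ψ' z).re ^ 2 + (ψ' z).im ^ 2 := by
    rw [← Complex.normSq_eq_norm_sq, Complex.normSq_apply]; ring
  have h0 : D1 (c * Complex.I * Complex.I) = - D1 c := by
    rw [mul_assoc, Complex.I_mul_I, mul_neg_one, map_neg]
  simp [T, hn]
  rw [hb (ψ' z) (ψ' z), hb (ψ' z * Complex.I) (ψ' z * Complex.I), h0]
  simp
  ring

lemma laplacian_radial {U U' : ℝ → ℝ} {c : ℝ} {z : ℂ}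
    (h1 : ∀ r, 0 ≤ r → HasDerivAt U (U' r) r) (h2 : HasDerivAt U' c (‖z‖ ^ 2)) :
    Δ (fun u : ℂ => U (‖u‖ ^ 2)) z = 4 * (U' (‖z‖ ^ 2) + ‖z‖ ^ 2 * c) := by
  have hN : ∀ u : ℂ, HasFDerivAt (fun u : ℂ => ‖u‖ ^ 2) (2 • innerSL ℝ u) u := fun u =>
    (hasStrictFDerivAt_norm_sq u).hasFDerivAt
  have e1 : ∀ u : ℂ, HasFDerivAt (fun u : ℂ => U (‖u‖ ^ 2))
      (U' (‖u‖ ^ 2) • (2 • innerSL ℝ u)) u := fun u =>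
    (h1 _ (by positivity)).comp_hasFDerivAt u (hN u)
  have e2 := (h2.comp_hasFDerivAt z (hN z)).smul
    ((innerSL ℝ (E := ℂ)).hasFDerivAt.const_smul (2 : ℕ) (x := z))
  rw [laplacian_of_hasFDerivAt (Filter.Eventually.of_forall e1) e2]
  have hn : ‖z‖ ^ 2 = z.re ^ 2 + z.im ^ 2 := by
    rw [← Complex.normSq_eq_norm_sq, Complex.normSq_apply]; ring
  have hI : ∀ x y : ℂ, innerSL ℝ x y = x.re * y.re + x.im * y.im := fun x y => by
    rw [innerSL_apply_apply, Complex.inner]; simp [Complex.mul_re]; ring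
  simp [hI]
  rw [hn]
  ring

lemma laplacian_finsetSum {ι : Type*} (t : Finset ι) {f : ι → ℂ → ℝ} {z : ℂ}
    (h : ∀ i ∈ t, ContDiffAt ℝ 2 (f i) z) :
    Δ (fun u => ∑ i ∈ t, f i u) z = ∑ i ∈ t, Δ (f i) z := by
  classical
  induction t using Finset.induction_on with
  | empty => simp
  | insert a t ha ih =>
    have h' : ∀ i ∈ t, ContDiffAt ℝ 2 (f i) z := fun i hi => h i (Finset.mem_insert_of_mem hi)
    have e : (fun u => ∑ i ∈ insert a t, f i u) = f a + fun u => ∑ i ∈ t, f i u := by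
      ext u; simp [Finset.sum_insert ha]
    rw [e, (h a (Finset.mem_insert_self _ _)).laplacian_add (ContDiffAt.sum h'), ih h',
      Finset.sum_insert ha]

/-! ### The Legendre equation -/

/-- The coefficients of the solution `∑ aₙ yⁿ` with `a₀ = 1` of the Legendre equation
`(y (1 - y) Q')' + i (i + 1) Q = 0` on `[0, 1]`, that is, of the shifted Legendre polynomial
`Pᵢ(1 - 2 y)`. -/
def legendreCoeff (i : ℕ) : ℕ → ℝ
  | 0 => 1
  | n + 1 => (n * (n + 1) - i * (i + 1)) / (n + 1) ^ 2 * legendreCoeff i n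

lemma legendreCoeff_eq_zero {i n : ℕ} (h : i < n) : legendreCoeff i n = 0 := by
  induction n, h using Nat.le_induction with
  | base => simp [legendreCoeff]
  | succ n _ ih => simp [legendreCoeff, ih]

open Polynomial in
lemma coeff_of_legendre_ode {Q : ℝ[X]} {i : ℕ}
    (h : X * (1 - X) * derivative (derivative Q) + (1 - 2 * X) * derivative Q
      + C ((i : ℝ) * (i + 1)) * Q = 0) (n : ℕ) : Q.coeff n = Q.coeff 0 * legendreCoeff i n := by
  induction n with
  | zero => simp [legendreCoeff]
  | succ n ih =>
    obtain ⟨κ, hκ⟩ : ∃ κ : ℝ, κ = i * (i + 1) := ⟨_, rfl⟩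
    rw [← hκ] at h
    have hn := congrArg (fun P : ℝ[X] => P.coeff n) h
    have e : X * (1 - X) * derivative (derivative Q) + (1 - 2 * X) * derivative Q
        + C κ * Q = X * derivative (derivative Q)
        - X * (X * derivative (derivative Q)) + derivative Q - C 2 * (X * derivative Q)
        + C κ * Q := by
      rw [show (C (2 : ℝ)) = 2 from rfl]; ring
    rw [e] at hn
    have hpos : ((n : ℝ) + 1) ≠ 0 := by positivity
    have e2 : ((n : ℝ) + 1) ^ 2 * Q.coeff (n + 1) = (n * (n + 1) - κ) * Q.coeff n := by
      rcases n with _ | _ | n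
      · simp [coeff_derivative] at hn ⊢
        linarith
      · simp [coeff_X_mul, coeff_derivative] at hn ⊢
        norm_num at hn ⊢
        linarith
      · simp [coeff_X_mul, coeff_derivative] at hn ⊢
        linarith
    rw [legendreCoeff, div_mul_eq_mul_div, mul_div_assoc', eq_div_iff (by positivity), mul_comm, e2,
      ih, hκ]
    ring

open Polynomial in
/-- On functions of the height `y = |z|² / (1 + |z|²)` the spherical Laplacian is the Legendre
operator `(y (1 - y) Q')'`. -/
lemma laplacian_polynomial_height (Q : ℝ[X]) (z : ℂ) :
    Δ (fun u : ℂ => Q.eval (‖u‖ ^ 2 / (1 + ‖u‖ ^ 2))) z = 4 / (1 + ‖z‖ ^ 2) ^ 2 *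
      (X * (1 - X) * derivative (derivative Q) + (1 - 2 * X) * derivative Q).eval
        (‖z‖ ^ 2 / (1 + ‖z‖ ^ 2)) := by
  have hy : ∀ r : ℝ, 0 ≤ r → HasDerivAt (fun r : ℝ => r / (1 + r)) (1 / (1 + r) ^ 2) r := by
    intro r hr
    have h : (1 + r) ≠ 0 := by positivity
    refine ((hasDerivAt_id r).div ((hasDerivAt_id r).const_add 1) h).congr_deriv ?_
    simp
  have h1 : ∀ (P : ℝ[X]) (r : ℝ), 0 ≤ r → HasDerivAt (fun r : ℝ => P.eval (r / (1 + r)))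
      ((derivative P).eval (r / (1 + r)) * (1 / (1 + r) ^ 2)) r := fun P r hr =>
    (P.hasDerivAt _).comp r (hy r hr)
  have hr : 0 ≤ ‖z‖ ^ 2 := by positivity
  have hp : (1 + ‖z‖ ^ 2) ≠ 0 := by positivity
  have hq : HasDerivAt (fun r : ℝ => 1 / (1 + r) ^ 2) (-2 / (1 + ‖z‖ ^ 2) ^ 3) (‖z‖ ^ 2) := by
    refine ((hasDerivAt_const (‖z‖ ^ 2) (1 : ℝ)).div
      (((hasDerivAt_id (‖z‖ ^ 2)).const_add 1).pow 2) (pow_ne_zero 2 hp)).congr_deriv ?_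
    simp
    field_simp
  rw [laplacian_radial (h1 Q) ((h1 (derivative Q) _ hr).mul hq)]
  simp
  field_simp
  ring

/-! ### Rotations of the sphere -/

/-- The action on the affine chart of a unitary rotation of `ℂP¹` that takes `0` to `w`; the unit
complex number `ζ` parametrizes these rotations. The value at the pole `1 = conj w * ζ * z` is
junk. -/
def moebius (w ζ z : ℂ) : ℂ := (ζ * z + w) / (1 - star w * ζ * z)

lemma mul_star_eq (z : ℂ) : z * star z = ((‖z‖ ^ 2 : ℝ) : ℂ) := by
  simpa using Complex.mul_conj' z

/-- The identity `|a|² + |b|² = (1 + |w|²)(1 + |z|²)` for the numerator `a` and the denominator `b`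
of `moebius w ζ z`. -/
lemma one_add_norm_sq_moebius {w ζ z : ℂ} (hζ : ‖ζ‖ = 1) (hd : 1 - star w * ζ * z ≠ 0) :
    1 + ‖moebius w ζ z‖ ^ 2 =
      (1 + ‖w‖ ^ 2) * (1 + ‖z‖ ^ 2) / ‖1 - star w * ζ * z‖ ^ 2 := by
  have hd' : ‖1 - star w * ζ * z‖ ≠ 0 := norm_ne_zero_iff.2 hd
  rw [moebius, norm_div, eq_div_iff (pow_ne_zero 2 hd'), div_pow, add_mul,
    div_mul_cancel₀ _ (pow_ne_zero 2 hd')]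
  have h1 : ‖ζ * z‖ ^ 2 = ‖z‖ ^ 2 := by rw [norm_mul, hζ, one_mul]
  rw [← h1, mul_assoc (star w)]
  generalize ζ * z = u
  apply Complex.ofReal_injective
  push_cast
  have h := fun x => (mul_star_eq x).symm
  push_cast at h
  simp only [h, star_sub, star_add, star_mul', star_one, star_star]
  ring

lemma hasDerivAt_moebius {w ζ z : ℂ} (hd : 1 - star w * ζ * z ≠ 0) :
    HasDerivAt (moebius w ζ)
      (ζ * ((1 + ‖w‖ ^ 2 : ℝ) : ℂ) / (1 - star w * ζ * z) ^ 2) z := by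
  have h1 : HasDerivAt (fun z : ℂ => ζ * z + w) ζ z := by
    simpa using ((hasDerivAt_id z).const_mul ζ).add_const w
  have h2 : HasDerivAt (fun z : ℂ => 1 - star w * ζ * z) (-(star w * ζ)) z := by
    simpa using ((hasDerivAt_id z).const_mul (star w * ζ)).const_sub 1
  refine (h1.div h2 hd).congr_deriv ?_
  congr 1
  have h := (mul_star_eq w).symm
  push_cast at h ⊢
  rw [h]
  ring

lemma differentiableAt_deriv_moebius {w ζ z : ℂ} (hd : 1 - star w * ζ * z ≠ 0) :
    DifferentiableAt ℂ (fun z => ζ * ((1 + ‖w‖ ^ 2 : ℝ) : ℂ) / (1 - star w * ζ * z) ^ 2) z := by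
  refine DifferentiableAt.div (by fun_prop) (by fun_prop) (pow_ne_zero 2 hd)

lemma norm_deriv_moebius {w ζ z : ℂ} (hζ : ‖ζ‖ = 1) :
    ‖ζ * ((1 + ‖w‖ ^ 2 : ℝ) : ℂ) / (1 - star w * ζ * z) ^ 2‖ =
      (1 + ‖w‖ ^ 2) / ‖1 - star w * ζ * z‖ ^ 2 := by
  rw [norm_div, norm_mul, hζ, one_mul, norm_pow, Complex.norm_real, Real.norm_of_nonneg
    (by positivity)]

/-- Rotations are isometries of the Fubini-Study metric. -/
lemma fsDensity_moebius {w ζ z : ℂ} (hζ : ‖ζ‖ = 1) (hd : 1 - star w * ζ * z ≠ 0) :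
    ‖ζ * ((1 + ‖w‖ ^ 2 : ℝ) : ℂ) / (1 - star w * ζ * z) ^ 2‖ ^ 2 * fsDensity (moebius w ζ z) =
      fsDensity z := by
  have hd' : ‖1 - star w * ζ * z‖ ≠ 0 := norm_ne_zero_iff.2 hd
  have hw : 1 + ‖w‖ ^ 2 ≠ 0 := by positivity
  rw [norm_deriv_moebius hζ, fsDensity, fsDensity, one_add_norm_sq_moebius hζ hd]
  field_simp

lemma det_restrictScalars_toSpanSingleton (c : ℂ) :
    ((ContinuousLinearMap.toSpanSingleton ℂ c).restrictScalars ℝ).det = ‖c‖ ^ 2 := by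
  have : (((ContinuousLinearMap.toSpanSingleton ℂ c).restrictScalars ℝ : ℂ →L[ℝ] ℂ) : ℂ →ₗ[ℝ] ℂ)
      = Algebra.lmul ℝ ℂ c := by
    ext x
    simp [mul_comm]
  rw [ContinuousLinearMap.det, this, ← Algebra.norm_apply, Algebra.norm_complex_apply,
    Complex.normSq_eq_norm_sq]

lemma injOn_moebius {w ζ : ℂ} (hζ : ‖ζ‖ = 1) :
    Set.InjOn (moebius w ζ) {z | 1 - star w * ζ * z ≠ 0} := by
  intro x hx y hy h
  have hζ' : ζ ≠ 0 := norm_ne_zero_iff.1 (by rw [hζ]; norm_num)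
  have hw : ((1 + ‖w‖ ^ 2 : ℝ) : ℂ) ≠ 0 := by
    rw [Complex.ofReal_ne_zero]; positivity
  simp only [moebius] at h
  rw [div_eq_div_iff hx hy] at h
  have e := (mul_star_eq w).symm
  have : ζ * ((1 + ‖w‖ ^ 2 : ℝ) : ℂ) * (x - y) = 0 := by
    push_cast at e ⊢
    rw [e]
    linear_combination h
  exact sub_eq_zero.1 ((mul_eq_zero.1 this).resolve_left (mul_ne_zero hζ' hw))

lemma ae_ne_pole (w ζ : ℂ) : ∀ᵐ z : ℂ, 1 - star w * ζ * z ≠ 0 := by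
  have : {z : ℂ | ¬ (1 - star w * ζ * z ≠ 0)}.Subsingleton := by
    intro x hx y hy
    simp only [ne_eq, not_not, Set.mem_ofPred_eq] at hx hy
    have h0 : star w * ζ ≠ 0 := by
      intro h
      rw [h] at hx
      simp at hx
    exact mul_left_cancel₀ h0 (by linear_combination hy - hx)
  exact this.measure_zero _

lemma integral_fsDensity_comp_moebius {E : Type*} [NormedAddCommGroup E] [NormedSpace ℝ E]
    {w ζ : ℂ} (hζ : ‖ζ‖ = 1) (f : ℂ → E) :
    ∫ z, fsDensity z • f (moebius w ζ z) = ∫ z, fsDensity z • f z := by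
  set s : Set ℂ := {z | 1 - star w * ζ * z ≠ 0} with hs
  have hso : IsOpen s := isOpen_ne_fun (by fun_prop) continuous_const
  have hsu : s =ᵐ[volume] Set.univ := by
    filter_upwards [ae_ne_pole w ζ] with z hz
    exact eq_true hz
  have him : moebius w ζ '' s =ᵐ[volume] Set.univ := by
    filter_upwards [ae_ne_pole (-w) 1] with u hu
    -- The rotation misses at most the image `-1 / conj w` of the point at infinity.
    refine eq_true ⟨star ζ * (u - w) / (1 + star w * u), ?_, ?_⟩
    all_goals
      have h1 : ζ * star ζ = 1 := by rw [mul_star_eq, hζ]; simp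
      have hu' : 1 + star w * u ≠ 0 := by simpa [sub_eq_add_neg] using hu
      have hw : ((1 + ‖w‖ ^ 2 : ℝ) : ℂ) ≠ 0 := by
        rw [Complex.ofReal_ne_zero]; positivity
      have e := (mul_star_eq w).symm
      have h2 : ζ * (star ζ * (u - w) / (1 + star w * u)) = (u - w) / (1 + star w * u) := by
        rw [mul_div_assoc', ← mul_assoc, h1, one_mul]
      have h3 : 1 - star w * ζ * (star ζ * (u - w) / (1 + star w * u)) =
          ((1 + ‖w‖ ^ 2 : ℝ) : ℂ) / (1 + star w * u) := by
        rw [mul_assoc, h2]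
        push_cast at e ⊢
        rw [e]
        field_simp
        ring
    · change _ ≠ _
      rw [h3]
      exact div_ne_zero hw hu'
    · rw [moebius, h3, h2]
      push_cast at e hw ⊢
      rw [e] at hw ⊢
      rw [div_add' _ _ _ hu', div_div_div_cancel_right₀ hu', div_eq_iff hw]
      ring
  have h := integral_image_eq_integral_abs_det_fderiv_smul volume hso.measurableSet
    (fun z hz => ((hasDerivAt_moebius (ζ := ζ) hz).hasFDerivAt.restrictScalars ℝ).hasFDerivWithinAt)
    (injOn_moebius hζ) (fun z => fsDensity z • f z)
  rw [setIntegral_congr_set him, setIntegral_univ] at h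
  rw [h, ← setIntegral_univ (μ := volume) (f := fun z => fsDensity z • f (moebius w ζ z)),
    ← setIntegral_congr_set hsu]
  refine setIntegral_congr_fun hso.measurableSet fun z hz => ?_
  rw [det_restrictScalars_toSpanSingleton, abs_of_nonneg (by positivity), smul_smul,
    fsDensity_moebius hζ hz]

/-! ### Beta integrals -/

/-- The beta integral `∫₀¹ (1 - y)ᵐ yⁿ dy = m! n! / (m + n + 1)!`. -/
def betaCoeff (m n : ℕ) : ℝ := (m.factorial * n.factorial : ℝ) / (m + n + 1).factorial

lemma betaCoeff_zero (m : ℕ) : betaCoeff m 0 = 1 / (m + 1) := by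
  rw [betaCoeff, Nat.add_zero, Nat.factorial_succ]
  push_cast
  have : (m.factorial : ℝ) ≠ 0 := by positivity
  simp
  field_simp

lemma betaCoeff_succ (m n : ℕ) : betaCoeff m (n + 1) = betaCoeff m n - betaCoeff (m + 1) n := by
  have h : (((m + n + 1).factorial : ℕ) : ℝ) ≠ 0 := by positivity
  have h' : (m : ℝ) + n + 1 + 1 ≠ 0 := by positivity
  rw [betaCoeff, betaCoeff, betaCoeff, show m + (n + 1) + 1 = (m + n + 1) + 1 by ring,
    show m + 1 + n + 1 = (m + n + 1) + 1 by ring, Nat.factorial_succ (m + n + 1),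
    Nat.factorial_succ n, Nat.factorial_succ m]
  push_cast
  field_simp
  ring

lemma integral_fsDensity_pow (m : ℕ) :
    ∫ z : ℂ, fsDensity z * (1 / (1 + ‖z‖ ^ 2)) ^ m = 1 / ((m : ℝ) + 1) := by
  have h := integral_fun_norm_addHaar (volume : Measure ℂ)
    (fun y : ℝ => 1 / (Real.pi * (1 + y ^ 2) ^ 2) * (1 / (1 + y ^ 2)) ^ m)
  simp only [fsDensity]
  rw [h, Complex.finrank_real_complex]
  have hd : ∀ y ∈ Set.Ioi (0 : ℝ), HasDerivAt
      (fun y : ℝ => - (1 / (2 * Real.pi * (m + 1))) * (1 / (1 + y ^ 2)) ^ (m + 1))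
      (y ^ (2 - 1) • (1 / (Real.pi * (1 + y ^ 2) ^ 2) * (1 / (1 + y ^ 2)) ^ m)) y := by
    intro y _
    have hp : (1 + y ^ 2) ≠ 0 := by positivity
    have hm : (m : ℝ) + 1 ≠ 0 := by positivity
    have h1 : HasDerivAt (fun y : ℝ => 1 / (1 + y ^ 2)) (-(2 * y) / (1 + y ^ 2) ^ 2) y := by
      refine ((hasDerivAt_const y (1 : ℝ)).div
        (((hasDerivAt_id y).pow 2).const_add 1) hp).congr_deriv ?_
      simp
    refine ((h1.pow (m + 1)).const_mul _).congr_deriv ?_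
    simp
    field_simp
  have hc : ContinuousWithinAt
      (fun y : ℝ => - (1 / (2 * Real.pi * (m + 1))) * (1 / (1 + y ^ 2)) ^ (m + 1))
      (Set.Ici 0) 0 := by
    refine Continuous.continuousWithinAt ?_
    refine continuous_const.mul ((continuous_const.div (by fun_prop) fun y => ?_).pow _)
    positivity
  have hl : Filter.Tendsto
      (fun y : ℝ => - (1 / (2 * Real.pi * (m + 1))) * (1 / (1 + y ^ 2)) ^ (m + 1)) Filter.atTop
      (𝓝 0) := by
    have h0 : Filter.Tendsto (fun y : ℝ => 1 / (1 + y ^ 2)) Filter.atTop (𝓝 0) := by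
      simp only [one_div]
      exact (Filter.tendsto_atTop_add_const_left _ _
        (Filter.tendsto_pow_atTop two_ne_zero)).inv_tendsto_atTop
    simpa using (h0.pow (m + 1)).const_mul (- (1 / (2 * Real.pi * (m + 1))))
  rw [integral_Ioi_of_hasDerivAt_of_nonneg hc hd ?_ hl]
  · simp [Measure.real]
    field_simp
  · intro y hy
    have : (0 : ℝ) < y := hy
    positivity

lemma continuous_height : Continuous fun z : ℂ => ‖z‖ ^ 2 / (1 + ‖z‖ ^ 2) :=
  Continuous.div (by fun_prop) (by fun_prop) fun z => by positivity

lemma continuous_coheight : Continuous fun z : ℂ => 1 / (1 + ‖z‖ ^ 2) :=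
  Continuous.div (by fun_prop) (by fun_prop) fun z => by positivity

lemma integrable_fsDensity_mul {f : ℂ → ℝ} (hf : Continuous f) {C : ℝ} (hC : ∀ z, |f z| ≤ C) :
    Integrable fun z => fsDensity z * f z :=
  integrable_fsDensity.mul_bdd hf.aestronglyMeasurable (Filter.Eventually.of_forall hC)

lemma integrable_beta (m n : ℕ) : Integrable fun z : ℂ =>
    fsDensity z * ((1 / (1 + ‖z‖ ^ 2)) ^ m * (‖z‖ ^ 2 / (1 + ‖z‖ ^ 2)) ^ n) := by
  refine integrable_fsDensity_mul ((continuous_coheight.pow m).mul (continuous_height.pow n))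
    (C := 1) fun z => ?_
  have h1 : 1 / (1 + ‖z‖ ^ 2) ≤ 1 := by
    rw [div_le_one (by positivity)]; nlinarith [sq_nonneg ‖z‖]
  have h2 : ‖z‖ ^ 2 / (1 + ‖z‖ ^ 2) ≤ 1 := by
    rw [div_le_one (by positivity)]; linarith
  rw [abs_of_nonneg (by positivity)]
  exact mul_le_one₀ (pow_le_one₀ (by positivity) h1) (by positivity)
    (pow_le_one₀ (by positivity) h2)

/-- The height `y = |z|² / (1 + |z|²)` is uniformly distributed on `[0, 1]` (Archimedes). -/
lemma integral_beta (m n : ℕ) : ∫ z : ℂ,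
    fsDensity z * ((1 / (1 + ‖z‖ ^ 2)) ^ m * (‖z‖ ^ 2 / (1 + ‖z‖ ^ 2)) ^ n) = betaCoeff m n := by
  induction n generalizing m with
  | zero => simpa [betaCoeff_zero] using integral_fsDensity_pow m
  | succ n ih =>
    rw [betaCoeff_succ, ← ih m, ← ih (m + 1), ← integral_sub (integrable_beta m n)
      (integrable_beta (m + 1) n)]
    congr 1
    ext z
    have : ‖z‖ ^ 2 / (1 + ‖z‖ ^ 2) = 1 - 1 / (1 + ‖z‖ ^ 2) := by
      field_simp; ring
    rw [this]
    ring

section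

open Polynomial

/-! ### The Funk-Hecke formula -/

lemma pow_mul_star_pow_ne_one {n : ℕ} (hn : n ≠ 0) {ζ : ℂ} (hζ : IsPrimitiveRoot ζ n) {c d : ℕ}
    (hc : c < n) (hd : d < n) (h : c ≠ d) : ζ ^ c * star ζ ^ d ≠ 1 := by
  have h1 : ζ * star ζ = 1 := by
    rw [mul_star_eq, hζ.norm'_eq_one hn]; simp
  intro hx
  have : ζ ^ c = ζ ^ d := by
    calc ζ ^ c = ζ ^ c * (ζ * star ζ) ^ d := by rw [h1, one_pow, mul_one]
      _ = ζ ^ d * (ζ ^ c * star ζ ^ d) := by rw [mul_pow]; ring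
      _ = ζ ^ d := by rw [hx, mul_one]
  exact h (hζ.pow_inj hc hd this)

lemma sum_pow_mul_star_pow {n : ℕ} (hn : n ≠ 0) {ζ : ℂ} (hζ : IsPrimitiveRoot ζ n) {c d : ℕ}
    (hc : c < n) (hd : d < n) :
    ∑ m ∈ Finset.range n, (ζ ^ m) ^ c * star ((ζ ^ m) ^ d) = if c = d then (n : ℂ) else 0 := by
  have h1 : ζ * star ζ = 1 := by
    rw [mul_star_eq, hζ.norm'_eq_one hn]; simp
  have e : ∀ m ∈ Finset.range n, (ζ ^ m) ^ c * star ((ζ ^ m) ^ d) = (ζ ^ c * star ζ ^ d) ^ m := by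
    intro m _
    rw [star_pow, star_pow, mul_pow, ← pow_mul, ← pow_mul, ← pow_mul, ← pow_mul, mul_comm m c,
      mul_comm m d]
  rw [Finset.sum_congr rfl e]
  split_ifs with h
  · subst h
    rw [← mul_pow, h1]
    simp
  · have hx := pow_mul_star_pow_ne_one hn hζ hc hd h
    have hp : (ζ ^ c * star ζ ^ d) ^ n = 1 := by
      rw [mul_pow, ← pow_mul, ← pow_mul, mul_comm c, mul_comm d, pow_mul, pow_mul, ← star_pow,
        hζ.pow_eq_one]
      simp
    rw [geom_sum_eq hx, hp, sub_self, zero_div]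

/-- Parseval's identity for the `n`-th roots of unity. -/
lemma sum_eval_mul_star_eval {n : ℕ} (hn : n ≠ 0) {ζ : ℂ} (hζ : IsPrimitiveRoot ζ n) {p q : ℂ[X]}
    (hp : p.natDegree < n) (hq : q.natDegree < n) (z : ℂ) :
    ∑ m ∈ Finset.range n, p.eval (ζ ^ m * z) * star (q.eval (ζ ^ m * z)) =
      n * ∑ c ∈ Finset.range n, p.coeff c * star (q.coeff c) * ((‖z‖ ^ 2 : ℝ) : ℂ) ^ c := by
  have e : ∀ m, p.eval (ζ ^ m * z) * star (q.eval (ζ ^ m * z)) =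
      ∑ c ∈ Finset.range n, ∑ d ∈ Finset.range n, p.coeff c * star (q.coeff d) *
        (z ^ c * star (z ^ d)) * ((ζ ^ m) ^ c * star ((ζ ^ m) ^ d)) := by
    intro m
    rw [eval_eq_sum_range' hp, eval_eq_sum_range' hq, star_sum, Finset.sum_mul_sum]
    refine Finset.sum_congr rfl fun c _ => Finset.sum_congr rfl fun d _ => ?_
    simp only [mul_pow, star_mul']
    ring
  simp only [e]
  rw [Finset.sum_comm, Finset.mul_sum]
  refine Finset.sum_congr rfl fun c hc => ?_
  rw [Finset.sum_comm]
  simp only [← Finset.mul_sum]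
  rw [Finset.sum_congr rfl fun d hd => by
    rw [sum_pow_mul_star_pow hn hζ (Finset.mem_range.1 hc) (Finset.mem_range.1 hd)]]
  simp only [mul_ite, mul_zero, Finset.sum_ite_eq, hc, if_true]
  rw [← mul_star_eq, mul_pow, star_pow]
  ring

variable {ι : Type*} [Fintype ι]

/-- Real functions of the form `N(z, conj z) / (1 + |z|²)ᵏ`, where `N` is the polynomial with
coefficient `M a b` at `z ^ e a * conj z ^ e b`. The bound `e a ≤ k`, which makes such a function
extend to the sphere, is a separate hypothesis. -/
def IsFormQuotient (k : ℕ) (e : ι → ℕ) (M : ι → ι → ℂ) (F : ℂ → ℝ) : Prop :=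
  ∀ z, (F z : ℂ) = (∑ a, ∑ b, M a b * (z ^ e a * star (z ^ e b))) / ((1 + ‖z‖ ^ 2 : ℝ) : ℂ) ^ k

lemma IsFormQuotient.abs_le {k : ℕ} {e : ι → ℕ} {M : ι → ι → ℂ} {F : ℂ → ℝ} (he : ∀ a, e a ≤ k)
    (hF : IsFormQuotient k e M F) (z : ℂ) : |F z| ≤ ∑ a, ∑ b, ‖M a b‖ := by
  have hp : 0 < 1 + ‖z‖ ^ 2 := by positivity
  have hs : 1 ≤ √(1 + ‖z‖ ^ 2) := by
    rw [Real.one_le_sqrt]; nlinarith [sq_nonneg ‖z‖]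
  have h1 : ∀ a, ‖z ^ e a‖ ≤ √(1 + ‖z‖ ^ 2) ^ k := fun a => by
    rw [norm_pow]
    refine (pow_le_pow_left₀ (norm_nonneg _) (Real.le_sqrt_of_sq_le ?_) _).trans
      (pow_le_pow_right₀ hs (he a))
    linarith
  rw [← Real.norm_eq_abs, ← Complex.norm_real, hF z, norm_div, norm_pow, Complex.norm_real,
    Real.norm_of_nonneg hp.le, div_le_iff₀ (pow_pos hp k), Finset.sum_mul]
  refine (norm_sum_le _ _).trans (Finset.sum_le_sum fun a _ => ?_)
  rw [Finset.sum_mul]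
  refine (norm_sum_le _ _).trans (Finset.sum_le_sum fun b _ => ?_)
  rw [norm_mul, norm_mul, norm_star]
  refine mul_le_mul_of_nonneg_left ?_ (norm_nonneg _)
  calc _ ≤ √(1 + ‖z‖ ^ 2) ^ k * √(1 + ‖z‖ ^ 2) ^ k :=
        mul_le_mul (h1 a) (h1 b) (norm_nonneg _) (by positivity)
    _ = _ := by rw [← mul_pow, Real.mul_self_sqrt hp.le]

/-- Summing over the rotations about `w` by `(k + 1)`-st roots of unity kills every nonradial term,
since the exponents occurring are at most `k`: what is left is a polynomial in the height above
`w`. -/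
lemma IsFormQuotient.exists_rotation_sum {k : ℕ} {e : ι → ℕ} {M : ι → ι → ℂ} {F : ℂ → ℝ}
    (he : ∀ a, e a ≤ k) (hF : IsFormQuotient k e M F) (w : ℂ) {ζ : ℂ}
    (hζ : IsPrimitiveRoot ζ (k + 1)) :
    ∃ Q : ℝ[X], ∀ z, (∀ m, 1 - star w * ζ ^ m * z ≠ 0) →
      ∑ m ∈ Finset.range (k + 1), F (moebius w (ζ ^ m) z) =
        Q.eval (‖z‖ ^ 2 / (1 + ‖z‖ ^ 2)) := by
  -- Up to the denominator, `x a` is the monomial `z ^ e a` pulled back by the rotation.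
  let x : ι → ℂ[X] := fun a => (X + C w) ^ e a * (1 - C (star w) * X) ^ (k - e a)
  have hx : ∀ a, (x a).natDegree < k + 1 := by
    intro a
    have h1 : ((X + C w : ℂ[X]) ^ e a).natDegree ≤ e a * 1 :=
      natDegree_pow_le_of_le _ (natDegree_X_add_C w).le
    have h2 : ((1 - C (star w) * X : ℂ[X]) ^ (k - e a)).natDegree ≤ (k - e a) * 1 := by
      refine natDegree_pow_le_of_le _ ((natDegree_sub_le _ _).trans (max_le (by simp) ?_))
      exact (natDegree_C_mul_le _ _).trans natDegree_X_le
    have h3 : (x a).natDegree ≤ _ := natDegree_mul_le_of_le h1 h2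
    have := he a
    omega
  let m' : ℕ → ℂ := fun c => (k + 1 : ℕ) *
    (∑ a, ∑ b, M a b * ((x a).coeff c * star ((x b).coeff c)))
    / ((1 + ‖w‖ ^ 2 : ℝ) : ℂ) ^ k
  refine ⟨∑ c ∈ Finset.range (k + 1), C (m' c).re * X ^ c * (1 - X) ^ (k - c), fun z hz => ?_⟩
  have hw : ((1 + ‖w‖ ^ 2 : ℝ) : ℂ) ≠ 0 := by rw [Complex.ofReal_ne_zero]; positivity
  have hr : ((1 + ‖z‖ ^ 2 : ℝ) : ℂ) ≠ 0 := by rw [Complex.ofReal_ne_zero]; positivity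
  have hζn : ∀ m, ‖ζ ^ m‖ = 1 := fun m => by
    rw [norm_pow, hζ.norm'_eq_one (Nat.succ_ne_zero k), one_pow]
  have h1 : ∀ m, (F (moebius w (ζ ^ m) z) : ℂ) = (∑ a, ∑ b, M a b *
      ((x a).eval (ζ ^ m * z) * star ((x b).eval (ζ ^ m * z)))) /
        (((1 + ‖w‖ ^ 2 : ℝ) : ℂ) ^ k * ((1 + ‖z‖ ^ 2 : ℝ) : ℂ) ^ k) := by
    intro m
    have hd := hz m
    have hd2 : star (1 - star w * ζ ^ m * z) ≠ 0 := star_ne_zero.2 hd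
    rw [hF, one_add_norm_sq_moebius (hζn m) hd]
    have hden : (((1 + ‖w‖ ^ 2) * (1 + ‖z‖ ^ 2) / ‖1 - star w * ζ ^ m * z‖ ^ 2 : ℝ) : ℂ) =
        ((1 + ‖w‖ ^ 2 : ℝ) : ℂ) * ((1 + ‖z‖ ^ 2 : ℝ) : ℂ) /
          ((1 - star w * ζ ^ m * z) * star (1 - star w * ζ ^ m * z)) := by
      rw [mul_star_eq]; push_cast; rfl
    rw [hden, div_pow, mul_pow, div_div_eq_mul_div, Finset.sum_mul]
    congr 1
    refine Finset.sum_congr rfl fun a _ => ?_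
    rw [Finset.sum_mul]
    refine Finset.sum_congr rfl fun b _ => ?_
    have key : ∀ a, moebius w (ζ ^ m) z ^ e a * (1 - star w * ζ ^ m * z) ^ k =
        (x a).eval (ζ ^ m * z) := by
      intro a
      simp only [x, moebius, eval_mul, eval_pow, eval_add, eval_X, eval_C, eval_sub, eval_one]
      rw [div_pow, ← mul_assoc, div_mul_eq_mul_div, div_eq_iff (pow_ne_zero _ hd),
        mul_assoc _ (_ ^ (k - e a)), ← pow_add, Nat.sub_add_cancel (he a)]
    rw [← key a, ← key b, star_mul', star_pow _ k, mul_pow]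
    ring
  have h2 : ((∑ m ∈ Finset.range (k + 1), F (moebius w (ζ ^ m) z) : ℝ) : ℂ) =
      ∑ c ∈ Finset.range (k + 1), m' c * ((‖z‖ ^ 2 / (1 + ‖z‖ ^ 2) : ℝ) : ℂ) ^ c *
        ((1 / (1 + ‖z‖ ^ 2) : ℝ) : ℂ) ^ (k - c) := by
    rw [Complex.ofReal_sum, Finset.sum_congr rfl fun m _ => h1 m, ← Finset.sum_div, Finset.sum_comm,
      Finset.sum_congr rfl fun a _ => Finset.sum_comm]
    simp only [← Finset.mul_sum]
    rw [Finset.sum_congr rfl fun a _ => Finset.sum_congr rfl fun b _ => by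
      rw [sum_eval_mul_star_eval (Nat.succ_ne_zero k) hζ (hx a) (hx b) z, Finset.mul_sum,
        Finset.mul_sum]]
    rw [Finset.sum_congr rfl fun a _ => Finset.sum_comm, Finset.sum_comm, Finset.sum_div]
    refine Finset.sum_congr rfl fun c hc => ?_
    have hck : c ≤ k := Nat.lt_succ_iff.1 (Finset.mem_range.1 hc)
    have h3 : ((‖z‖ ^ 2 / (1 + ‖z‖ ^ 2) : ℝ) : ℂ) ^ c * ((1 / (1 + ‖z‖ ^ 2) : ℝ) : ℂ) ^ (k - c) =
        ((‖z‖ ^ 2 : ℝ) : ℂ) ^ c / ((1 + ‖z‖ ^ 2 : ℝ) : ℂ) ^ k := by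
      rw [Complex.ofReal_div, Complex.ofReal_div, div_pow, div_pow, div_mul_div_comm, ← pow_add,
        Nat.add_sub_cancel' hck]
      simp
    rw [mul_assoc, h3]
    simp only [m']
    rw [div_mul_div_comm]
    congr 1
    rw [Finset.mul_sum, Finset.sum_mul]
    refine Finset.sum_congr rfl fun a _ => ?_
    rw [Finset.mul_sum, Finset.sum_mul]
    refine Finset.sum_congr rfl fun b _ => ?_
    ring
  have h4 := congrArg Complex.re h2
  rw [Complex.ofReal_re] at h4
  rw [h4, Complex.re_sum, eval_finsetSum]
  refine Finset.sum_congr rfl fun c _ => ?_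
  have h5 : 1 - ‖z‖ ^ 2 / (1 + ‖z‖ ^ 2) = 1 / (1 + ‖z‖ ^ 2) := by
    have : (1 + ‖z‖ ^ 2) ≠ 0 := by positivity
    field_simp; ring
  rw [← Complex.ofReal_pow, ← Complex.ofReal_pow, Complex.re_mul_ofReal, Complex.re_mul_ofReal]
  simp only [eval_mul, eval_C, eval_pow, eval_X, eval_sub, eval_one, h5]

/-- The transition probability `|⟨W, Z⟩|² / (|W|² |Z|²)` of the lines spanned by `W = (1, w)` and
`Z = (1, z)`. -/
def overlap (w z : ℂ) : ℝ := ‖1 + star w * z‖ ^ 2 / ((1 + ‖w‖ ^ 2) * (1 + ‖z‖ ^ 2))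

lemma overlap_moebius {w ζ z : ℂ} (hζ : ‖ζ‖ = 1) (hd : 1 - star w * ζ * z ≠ 0) :
    overlap w (moebius w ζ z) = 1 / (1 + ‖z‖ ^ 2) := by
  have hd' : ‖1 - star w * ζ * z‖ ≠ 0 := norm_ne_zero_iff.2 hd
  have e : 1 + star w * moebius w ζ z = ((1 + ‖w‖ ^ 2 : ℝ) : ℂ) / (1 - star w * ζ * z) := by
    have h := (mul_star_eq w).symm
    rw [moebius, eq_div_iff hd]
    push_cast at h ⊢
    rw [h]
    field_simp
    ring
  have hw : 1 + ‖w‖ ^ 2 ≠ 0 := by positivity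
  rw [overlap, one_add_norm_sq_moebius hζ hd, e, norm_div, Complex.norm_real,
    Real.norm_of_nonneg (by positivity)]
  field_simp

/-- The eigenvalue of the integral operator with kernel `overlap w z ^ k` on the `i`-th eigenspace of
the Laplacian: `∫₀¹ (1 - y)ᵏ Pᵢ(1 - 2 y) dy`, expanded in beta integrals. The coefficients with
`n > i` vanish; the term `n = i + 1` is kept so that the two leading terms are always present. -/
def funkHecke (k i : ℕ) : ℝ := ∑ n ∈ Finset.range (i + 2), legendreCoeff i n * betaCoeff k n

/-- The Funk-Hecke formula: on an eigenfunction of the Laplacian, the integral operator with kernel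
`overlap w z ^ k` is multiplication by `funkHecke k i`. -/
theorem IsFormQuotient.integral_overlap {k : ℕ} {e : ι → ℕ} {M : ι → ι → ℂ} {F : ℂ → ℝ}
    (he : ∀ a, e a ≤ k) (hF : IsFormQuotient k e M F) (hs : ContDiff ℝ 2 F) {i : ℕ}
    (hΔ : ∀ z, Δ F z = -(4 * (i * (i + 1)) / (1 + ‖z‖ ^ 2) ^ 2) * F z) (w : ℂ) :
    ∫ z, fsDensity z * (F z * overlap w z ^ k) = funkHecke k i * F w := by
  obtain ⟨ζ, hζ⟩ : ∃ ζ : ℂ, IsPrimitiveRoot ζ (k + 1) :=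
    ⟨_, Complex.isPrimitiveRoot_exp (k + 1) (Nat.succ_ne_zero k)⟩
  have hζn : ∀ m, ‖ζ ^ m‖ = 1 := fun m => by
    rw [norm_pow, hζ.norm'_eq_one (Nat.succ_ne_zero k), one_pow]
  obtain ⟨Q, hQ⟩ := hF.exists_rotation_sum he w hζ
  have hsmall : ∀ z : ℂ, ‖w‖ * ‖z‖ < 1 → ∀ m, 1 - star w * ζ ^ m * z ≠ 0 := by
    intro z hz m h
    have := congrArg norm (sub_eq_zero.1 h)
    rw [norm_one, norm_mul, norm_mul, norm_star, hζn m, mul_one] at this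
    linarith
  have hQ0 : Q.coeff 0 = (k + 1 : ℕ) * F w := by
    have := hQ 0 (hsmall 0 (by simp))
    simp only [moebius, mul_zero, zero_add, sub_zero, div_one, norm_zero] at this
    rw [coeff_zero_eq_eval_zero]
    simpa using this.symm
  -- Near `w` the sum of the rotated functions is `Q` of the height, so the eigenvalue equation holds
  -- for `Q` on an interval, hence identically.
  have hode : X * (1 - X) * derivative (derivative Q) + (1 - 2 * X) * derivative Q
      + C ((i : ℝ) * (i + 1)) * Q = 0 := by
    refine Polynomial.eq_zero_of_infinite_isRoot _ (Set.Infinite.mono (s :=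
      Set.Ioo (0 : ℝ) (1 / (1 + ‖w‖ ^ 2))) (fun y hy => ?_) (Set.Ioo_infinite (by positivity)))
    obtain ⟨hy0, hy1⟩ := hy
    rw [lt_div_iff₀ (by positivity)] at hy1
    have hy2 : y < 1 := by nlinarith [sq_nonneg ‖w‖]
    obtain ⟨z, hz⟩ : ∃ z : ℂ, ‖z‖ ^ 2 = y / (1 - y) := by
      refine ⟨(√(y / (1 - y)) : ℝ), ?_⟩
      rw [Complex.norm_real, Real.norm_of_nonneg (Real.sqrt_nonneg _), Real.sq_sqrt]
      exact div_nonneg hy0.le (by linarith)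
    have hyz : ‖z‖ ^ 2 / (1 + ‖z‖ ^ 2) = y := by
      have : 1 - y ≠ 0 := by linarith
      rw [hz]; field_simp; ring
    have hzw : ‖w‖ * ‖z‖ < 1 := by
      have : (‖w‖ * ‖z‖) ^ 2 < 1 := by
        rw [mul_pow, hz, mul_div_assoc', div_lt_one (by linarith)]
        linarith
      exact (sq_lt_one_iff₀ (by positivity)).1 this
    have hnear : ∀ᶠ u in 𝓝 z, ‖w‖ * ‖u‖ < 1 :=
      (continuous_const.mul continuous_norm).continuousAt.eventually (gt_mem_nhds hzw)
    have hG : (fun u => ∑ m ∈ Finset.range (k + 1), F (moebius w (ζ ^ m) u)) =ᶠ[𝓝 z]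
        fun u => Q.eval (‖u‖ ^ 2 / (1 + ‖u‖ ^ 2)) :=
      hnear.mono fun u hu => hQ u (hsmall u hu)
    have hL := (InnerProductSpace.laplacian_congr_nhds hG).self_of_nhds
    have hcd : ∀ m, ContDiffAt ℝ 2 (fun u => F (moebius w (ζ ^ m) u)) z := fun m => by
      refine hs.contDiffAt.comp z ?_
      unfold moebius
      have h : ContDiffAt ℂ 2 (fun z => (ζ ^ m * z + w) / (1 - star w * ζ ^ m * z)) z :=
        ContDiffAt.div (by fun_prop) (by fun_prop) (hsmall z hzw m)
      exact h.restrict_scalars ℝ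
    have hterm : ∀ m, Δ (fun u => F (moebius w (ζ ^ m) u)) z =
        -(4 * (i * (i + 1)) / (1 + ‖z‖ ^ 2) ^ 2) * F (moebius w (ζ ^ m) z) := by
      intro m
      have hd := hsmall z hzw m
      rw [laplacian_comp_holomorphic hs
        (hnear.mono fun u hu => hasDerivAt_moebius (hsmall u hu m))
        (differentiableAt_deriv_moebius hd).hasDerivAt, hΔ, norm_deriv_moebius (hζn m),
        one_add_norm_sq_moebius (hζn m) hd]
      have hd' : ‖1 - star w * ζ ^ m * z‖ ≠ 0 := norm_ne_zero_iff.2 hd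
      have hw' : 1 + ‖w‖ ^ 2 ≠ 0 := by positivity
      have hz' : 1 + ‖z‖ ^ 2 ≠ 0 := by positivity
      field_simp
    rw [laplacian_finsetSum _ fun m _ => hcd m, Finset.sum_congr rfl fun m _ => hterm m,
      ← Finset.mul_sum, hQ z (hsmall z hzw), laplacian_polynomial_height, hyz] at hL
    have hz' : 1 + ‖z‖ ^ 2 ≠ 0 := by positivity
    field_simp at hL
    change Polynomial.eval y _ = 0
    simp only [eval_add, eval_mul, eval_C] at hL ⊢
    linear_combination -hL
  have hcoeff := coeff_of_legendre_ode hode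
  have hdeg : Q.natDegree < i + 2 := by
    have : Q.natDegree ≤ i + 1 := natDegree_le_iff_coeff_eq_zero.2 fun n hn => by
      rw [hcoeff, legendreCoeff_eq_zero (by omega), mul_zero]
    omega
  have hint : ∀ m ∈ Finset.range (k + 1), Integrable fun z =>
      fsDensity z * (F (moebius w (ζ ^ m) z) * overlap w (moebius w (ζ ^ m) z) ^ k) := by
    intro m _
    have hb : ∀ᵐ z, ‖F (moebius w (ζ ^ m) z) * overlap w (moebius w (ζ ^ m) z) ^ k‖ ≤
        ∑ a, ∑ b, ‖M a b‖ := by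
      filter_upwards [ae_ne_pole w (ζ ^ m)] with z hz
      rw [overlap_moebius (hζn m) hz, norm_mul, Real.norm_eq_abs]
      have h1 : 1 / (1 + ‖z‖ ^ 2) ≤ 1 := by
        rw [div_le_one (by positivity)]; nlinarith [sq_nonneg ‖z‖]
      have h2 : ‖(1 / (1 + ‖z‖ ^ 2)) ^ k‖ ≤ 1 := by
        rw [Real.norm_of_nonneg (by positivity)]
        exact pow_le_one₀ (by positivity) h1
      calc _ ≤ |F (moebius w (ζ ^ m) z)| * 1 := mul_le_mul_of_nonneg_left h2 (abs_nonneg _)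
        _ ≤ _ := by rw [mul_one]; exact hF.abs_le he _
    refine integrable_fsDensity.mul_bdd (Measurable.aestronglyMeasurable ?_) hb
    have hm : Measurable (moebius w (ζ ^ m)) := by unfold moebius; fun_prop
    have ho : Measurable (overlap w) := by unfold overlap; fun_prop
    exact (hs.continuous.measurable.comp hm).mul ((ho.comp hm).pow_const k)
  have hk : ((k + 1 : ℕ) : ℝ) ≠ 0 := by positivity
  refine mul_left_cancel₀ hk ?_
  calc ((k + 1 : ℕ) : ℝ) * ∫ z, fsDensity z * (F z * overlap w z ^ k)
      = ∑ m ∈ Finset.range (k + 1), ∫ z,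
          fsDensity z * (F (moebius w (ζ ^ m) z) * overlap w (moebius w (ζ ^ m) z) ^ k) := by
        have hm := fun m => integral_fsDensity_comp_moebius (w := w) (hζn m)
          (fun z => F z * overlap w z ^ k)
        simp only [smul_eq_mul] at hm
        simp [hm]
    _ = ∫ z, ∑ n ∈ Finset.range (i + 2), Q.coeff n * (fsDensity z *
          ((1 / (1 + ‖z‖ ^ 2)) ^ k * (‖z‖ ^ 2 / (1 + ‖z‖ ^ 2)) ^ n)) := by
        rw [← integral_finsetSum _ hint]
        refine integral_congr_ae ?_
        filter_upwards [ae_all_iff.2 fun m : ℕ => ae_ne_pole w (ζ ^ m)] with z hz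
        simp only [overlap_moebius (hζn _) (hz _)]
        rw [← Finset.mul_sum, ← Finset.sum_mul, hQ z hz, eval_eq_sum_range' hdeg, Finset.sum_mul,
          Finset.mul_sum]
        refine Finset.sum_congr rfl fun n _ => by ring
    _ = ∑ n ∈ Finset.range (i + 2), Q.coeff n * betaCoeff k n := by
        rw [integral_finsetSum _ fun n _ => (integrable_beta k n).const_mul _]
        simp only [integral_const_mul, integral_beta]
    _ = _ := by
        rw [funkHecke, Finset.sum_mul, Finset.mul_sum]
        refine Finset.sum_congr rfl fun n _ => ?_
        rw [hcoeff, hQ0]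
        ring

end

open Matrix

/-! ### Sesquilinear forms -/

lemma eq_zero_of_eval_ofReal {p : Polynomial ℂ} (h : ∀ x : ℝ, p.eval (x : ℂ) = 0) : p = 0 :=
  Polynomial.eq_zero_of_infinite_isRoot _ ((Set.infinite_range_of_injective
    Complex.ofReal_injective).mono (by rintro _ ⟨x, rfl⟩; exact h x))

open Polynomial in
/-- A polynomial in `z` and `conj z` that vanishes identically has zero coefficients: writing
`z = x + I y`, the identity extends from real to complex `x` and `y`, which makes `z` and `conj z`
independent. -/
lemma coeff_eq_zero_of_sum_pow_mul_star_pow {ι : Type*} [Fintype ι] {e : ι → ℕ}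
    (he : Function.Injective e) {c : ι → ι → ℂ}
    (h : ∀ z : ℂ, ∑ a, ∑ b, c a b * (z ^ e a * star z ^ e b) = 0) (a b : ι) : c a b = 0 := by
  have h1 : ∀ x y : ℂ, ∑ a, ∑ b, c a b *
      ((x + Complex.I * y) ^ e a * (x - Complex.I * y) ^ e b) = 0 := by
    have h2 : ∀ (x : ℝ) (y : ℂ), ∑ a, ∑ b, c a b *
        (((x : ℂ) + Complex.I * y) ^ e a * ((x : ℂ) - Complex.I * y) ^ e b) = 0 := by
      intro x y
      have := eq_zero_of_eval_ofReal (p := ∑ a, ∑ b, C (c a b) *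
        ((C (x : ℂ) + C Complex.I * X) ^ e a * (C (x : ℂ) - C Complex.I * X) ^ e b)) fun y => by
          have := h (x + Complex.I * y)
          simp only [star_add, star_mul', Complex.star_def, Complex.conj_ofReal,
            Complex.conj_I] at this
          simpa [eval_finsetSum, sub_eq_add_neg] using this
      simpa [eval_finsetSum] using congrArg (eval y) this
    intro x y
    have := eq_zero_of_eval_ofReal (p := ∑ a, ∑ b, C (c a b) *
        ((X + C (Complex.I * y)) ^ e a * (X - C (Complex.I * y)) ^ e b)) fun x => by
          simpa [eval_finsetSum] using h2 x y
    simpa [eval_finsetSum] using congrArg (eval x) this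
  have h3 : ∀ z w : ℂ, ∑ a, (∑ b, c a b * w ^ e b) * z ^ e a = 0 := by
    intro z w
    rw [← h1 ((z + w) / 2) (-Complex.I * (z - w) / 2)]
    refine Finset.sum_congr rfl fun a _ => ?_
    rw [Finset.sum_mul]
    refine Finset.sum_congr rfl fun b _ => ?_
    have e1 : (z + w) / 2 + Complex.I * (-Complex.I * (z - w) / 2) = z := by
      linear_combination (-(z - w) / 2) * Complex.I_mul_I
    have e2 : (z + w) / 2 - Complex.I * (-Complex.I * (z - w) / 2) = w := by
      linear_combination ((z - w) / 2) * Complex.I_mul_I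
    rw [e1, e2]
    ring
  have h4 : ∀ (d : ι → ℂ), (∀ z, ∑ a, d a * z ^ e a = 0) → ∀ a, d a = 0 := by
    intro d hd a
    have := Polynomial.funext (p := ∑ a, C (d a) * X ^ e a) (q := 0) fun z => by
      simpa [eval_finsetSum] using hd z
    have := congrArg (fun p => coeff p (e a)) this
    simp only [finsetSum_coeff, coeff_C_mul, coeff_X_pow, coeff_zero] at this
    rw [Finset.sum_eq_single a (fun x _ hx => by
      rw [if_neg fun h => hx (he h).symm, mul_zero]) (by simp)] at this
    simpa using this
  exact h4 _ (fun w => h4 _ (fun z => h3 z w) a) b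

lemma trace_mul_vecMulVec {n : Type*} [Fintype n] (A : Matrix n n ℂ) (x y : n → ℂ) :
    (A * vecMulVec x y).trace = y ⬝ᵥ (A *ᵥ x) := by
  rw [mul_vecMulVec, trace_vecMulVec, dotProduct_comm]

/-- The square of the Hermitian norm. -/
def normSq {n : Type*} [Fintype n] (x : n → ℂ) : ℝ := ∑ j, ‖x j‖ ^ 2

lemma star_dotProduct_self {n : Type*} [Fintype n] (x : n → ℂ) :
    star x ⬝ᵥ x = (normSq x : ℂ) := by
  simp only [dotProduct, normSq, Complex.ofReal_sum, Pi.star_apply]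
  exact Finset.sum_congr rfl fun j _ => by rw [mul_comm, mul_star_eq]

lemma normSq_nonneg {n : Type*} [Fintype n] (x : n → ℂ) : 0 ≤ normSq x :=
  Finset.sum_nonneg fun _ _ => by positivity

lemma normSq_eq_zero {n : Type*} [Fintype n] {x : n → ℂ} : normSq x = 0 ↔ x = 0 := by
  rw [normSq, Finset.sum_eq_zero_iff_of_nonneg fun _ _ => by positivity]
  simp [funext_iff]

/-- The conjugate transpose is the adjoint for the standard Hermitian form. -/
lemma star_mulVec_dotProduct {n : Type*} [Fintype n] (g : Matrix n n ℂ) (x y : n → ℂ) :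
    star (g *ᵥ x) ⬝ᵥ y = star x ⬝ᵥ (gᴴ *ᵥ y) := by
  rw [star_mulVec, ← dotProduct_mulVec]

lemma norm_sq_toLp {n : Type*} [Fintype n] (x : EuclideanSpace ℂ n) :
    ‖x‖ ^ 2 = normSq x.ofLp := EuclideanSpace.norm_sq_eq x

/-! ### The standard basis -/

/-- The section `√(k choose j) Z₀ʲ Z₁ᵏ⁻ʲ` of `O(k)`. -/
def binomialMonomial (k : ℕ) (j : Fin (k + 1)) : MvPolynomial.homogeneousSubmodule (Fin 2) ℂ k :=
  ⟨MvPolynomial.C ((Real.sqrt (k.choose j) : ℝ) : ℂ) *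
          MvPolynomial.X 0 ^ (j : ℕ) * MvPolynomial.X 1 ^ (k - j : ℕ), by
    have h := ((MvPolynomial.isHomogeneous_C (Fin 2) ((Real.sqrt (k.choose j) : ℝ) : ℂ)).mul
      (MvPolynomial.isHomogeneous_X_pow (0 : Fin 2) (j : ℕ))).mul
      (MvPolynomial.isHomogeneous_X_pow (R := ℂ) (1 : Fin 2) (k - j : ℕ))
    rwa [zero_add, Nat.add_sub_cancel' (Nat.lt_succ_iff.1 j.2)] at h⟩

lemma sqrt_choose_ne_zero {k : ℕ} (j : Fin (k + 1)) : ((Real.sqrt (k.choose j) : ℝ) : ℂ) ≠ 0 := by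
  rw [Complex.ofReal_ne_zero, Real.sqrt_ne_zero']
  exact_mod_cast Nat.choose_pos (Nat.lt_succ_iff.1 j.2)

lemma coeff_binomialMonomial {k : ℕ} (j : Fin (k + 1)) {d : Fin 2 →₀ ℕ} (hd : d 0 + d 1 = k) :
    (binomialMonomial k j : MvPolynomial (Fin 2) ℂ).coeff d =
      if (j : ℕ) = d 0 then ((Real.sqrt (k.choose j) : ℝ) : ℂ) else 0 := by
  have hj := Nat.lt_succ_iff.1 j.2
  have e : (binomialMonomial k j : MvPolynomial (Fin 2) ℂ) = MvPolynomial.monomial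
      (Finsupp.single 0 (j : ℕ) + Finsupp.single 1 (k - j)) ((Real.sqrt (k.choose j) : ℝ) : ℂ) := by
    simp only [binomialMonomial, MvPolynomial.X_pow_eq_monomial, MvPolynomial.C_mul_monomial,
      MvPolynomial.monomial_mul, mul_one]
  rw [e, MvPolynomial.coeff_monomial]
  congr 1
  rw [Finsupp.ext_iff]
  simp only [Fin.forall_fin_two, eq_iff_iff]
  simp
  omega

/-- The basis `√(k choose j) Z₀ʲ Z₁ᵏ⁻ʲ` of the sections of `O(k)`; it is orthonormal up to scale for
the Fubini-Study inner product. -/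
def binomialBasis (k : ℕ) : SectionBasis k := by
  refine Module.Basis.mk (v := binomialMonomial k) ?_ ?_
  · rw [Fintype.linearIndependent_iff]
    intro c hc j
    have h := congrArg (fun q : MvPolynomial.homogeneousSubmodule (Fin 2) ℂ k =>
      (q : MvPolynomial (Fin 2) ℂ).coeff (Finsupp.single 0 (j : ℕ) + Finsupp.single 1 (k - j))) hc
    have hj := Nat.lt_succ_iff.1 j.2
    simp only [Submodule.coe_sum, Submodule.coe_smul, MvPolynomial.coeff_sum,
      MvPolynomial.coeff_smul] at h
    rw [Finset.sum_congr rfl fun l _ => by rw [coeff_binomialMonomial l (by simp; omega)]] at h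
    simp [Fin.val_inj] at h
    exact h.resolve_right (Nat.choose_pos hj).ne'
  · intro q _
    rw [Submodule.mem_span_range_iff_exists_fun]
    refine ⟨fun j => (q : MvPolynomial (Fin 2) ℂ).coeff
      (Finsupp.single 0 (j : ℕ) + Finsupp.single 1 (k - j)) / ((Real.sqrt (k.choose j) : ℝ) : ℂ), ?_⟩
    refine Subtype.ext (MvPolynomial.ext _ _ fun d => ?_)
    simp only [Submodule.coe_sum, Submodule.coe_smul, MvPolynomial.coeff_sum,
      MvPolynomial.coeff_smul]
    by_cases hd : d 0 + d 1 = k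
    · rw [Finset.sum_congr rfl fun l _ => by rw [coeff_binomialMonomial l hd],
        Finset.sum_eq_single (⟨d 0, by omega⟩ : Fin (k + 1))]
      · have h1 := sqrt_choose_ne_zero (⟨d 0, by omega⟩ : Fin (k + 1))
        simp only at h1
        simp only [if_true, smul_eq_mul]
        rw [div_mul_cancel₀ _ h1]
        congr 1
        ext i
        fin_cases i <;> simp
        omega
      · intro j _ hj
        rw [if_neg fun h => hj (Fin.ext h), smul_zero]
      · simp
    · have hz : ∀ p : MvPolynomial.homogeneousSubmodule (Fin 2) ℂ k,
          (p : MvPolynomial (Fin 2) ℂ).coeff d = 0 := fun p =>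
        MvPolynomial.IsHomogeneous.coeff_eq_zero p.2 (by
          rwa [Finsupp.degree_eq_sum, Fin.sum_univ_two])
      simp [hz]

lemma binomialBasis_apply (k : ℕ) (j : Fin (k + 1)) :
    (binomialBasis k j : MvPolynomial (Fin 2) ℂ) =
      MvPolynomial.C ((Real.sqrt (k.choose j) : ℝ) : ℂ) *
          MvPolynomial.X 0 ^ (j : ℕ) * MvPolynomial.X 1 ^ (k - j : ℕ) := by
  simp [binomialBasis, binomialMonomial]

/-- The coherent state at `z`: the values at `(1, z)` of the binomial basis. -/
def coherent (k : ℕ) (z : ℂ) : Fin (k + 1) → ℂ := fun j =>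
  ((Real.sqrt (k.choose j) : ℝ) : ℂ) * z ^ (k - j : ℕ)

/-- The values at `(1, z)` of the sections of a basis. -/
def affineVec {k : ℕ} (s : SectionBasis k) (z : ℂ) : Fin (k + 1) → ℂ :=
  (sectionVec s (chartVec 0 z)).ofLp

lemma affineVec_binomialBasis (k : ℕ) (z : ℂ) : affineVec (binomialBasis k) z = coherent k z := by
  ext j
  simp [affineVec, sectionVec, binomialBasis_apply, coherent, chartVec]

/-- The binomial basis represents the reproducing kernel `⟨W, Z⟩ᵏ`. -/
lemma star_coherent_dotProduct (k : ℕ) (w z : ℂ) :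
    star (coherent k w) ⬝ᵥ coherent k z = (1 + star w * z) ^ k := by
  rw [add_pow, Finset.sum_range]
  refine Finset.sum_congr rfl fun j _ => ?_
  have h : ((Real.sqrt (k.choose j) : ℝ) : ℂ) * ((Real.sqrt (k.choose j) : ℝ) : ℂ) =
      (k.choose j : ℂ) := by
    rw [← Complex.ofReal_mul, Real.mul_self_sqrt (by positivity)]; simp
  simp only [coherent, Pi.star_apply, star_mul', star_pow, Complex.star_def, Complex.conj_ofReal,
    one_pow, one_mul, mul_pow]
  rw [← h]
  ring

lemma normSq_coherent (k : ℕ) (z : ℂ) : normSq (coherent k z) = (1 + ‖z‖ ^ 2) ^ k := by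
  apply Complex.ofReal_injective
  rw [← star_dotProduct_self, star_coherent_dotProduct, mul_comm, mul_star_eq]
  push_cast
  rfl

/-- An operator is determined by its expectations in the coherent states. -/
lemma eq_zero_of_coherent_dotProduct {k : ℕ} {A : Matrix (Fin (k + 1)) (Fin (k + 1)) ℂ}
    (h : ∀ z, star (coherent k z) ⬝ᵥ (A *ᵥ coherent k z) = 0) : A = 0 := by
  have he : Function.Injective fun j : Fin (k + 1) => k - (j : ℕ) := by
    intro a b hab
    ext
    have := a.2
    have := b.2
    simp only at hab
    omega
  ext b a
  have := coeff_eq_zero_of_sum_pow_mul_star_pow he (c := fun a b =>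
    A b a * (((Real.sqrt (k.choose a) : ℝ) : ℂ) * ((Real.sqrt (k.choose b) : ℝ) : ℂ))) (fun z => by
      rw [← h z, dotProduct, Finset.sum_comm]
      refine Finset.sum_congr rfl fun b _ => ?_
      rw [mulVec, dotProduct, Finset.mul_sum]
      refine Finset.sum_congr rfl fun a _ => ?_
      simp only [coherent, Pi.star_apply, star_mul', star_pow, Complex.star_def,
        Complex.conj_ofReal]
      ring) a b
  exact (mul_eq_zero.1 this).resolve_right
    (mul_ne_zero (sqrt_choose_ne_zero _) (sqrt_choose_ne_zero _))

lemma normSq_affineVec_pos {k : ℕ} (s : SectionBasis k) (z : ℂ) : 0 < normSq (affineVec s z) := by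
  refine (normSq_nonneg _).lt_of_ne' fun h => ?_
  rw [normSq_eq_zero] at h
  exact sectionVec_ne_zero s (chartVec_ne_zero 0 z) (by ext j; exact congrFun h j)

lemma momentMap_chart {k : ℕ} (s : SectionBasis k) (z : ℂ) :
    momentMap (embedding s (chart 0 z)) = ((normSq (affineVec s z) : ℝ) : ℂ)⁻¹ •
      vecMulVec (affineVec s z) (star (affineVec s z)) := by
  rw [chart, embedding_mk, momentMap_mk]
  ext a b
  rw [norm_sq_toLp]
  simp only [Matrix.of_apply, Matrix.smul_apply, vecMulVec_apply, Pi.star_apply, smul_eq_mul,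
    affineVec]
  rw [div_eq_inv_mul]

lemma trace_mul_momentMap_chart {k : ℕ} (s : SectionBasis k)
    (A : Matrix (Fin (k + 1)) (Fin (k + 1)) ℂ) (z : ℂ) :
    (A * momentMap (embedding s (chart 0 z))).trace =
      (star (affineVec s z) ⬝ᵥ (A *ᵥ affineVec s z)) / ((normSq (affineVec s z) : ℝ) : ℂ) := by
  rw [momentMap_chart, Matrix.mul_smul, Matrix.trace_smul, trace_mul_vecMulVec, smul_eq_mul,
    div_eq_inv_mul]

lemma norm_momentMap_chart_le {k : ℕ} (s : SectionBasis k) (z : ℂ) (a b : Fin (k + 1)) :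
    ‖momentMap (embedding s (chart 0 z)) a b‖ ≤ 1 := by
  have hp := normSq_affineVec_pos s z
  have h1 : ∀ a, ‖affineVec s z a‖ ^ 2 ≤ normSq (affineVec s z) := fun a =>
    Finset.single_le_sum (f := fun j => ‖affineVec s z j‖ ^ 2) (fun _ _ => by positivity)
      (Finset.mem_univ a)
  rw [momentMap_chart, Matrix.smul_apply, vecMulVec_apply, smul_eq_mul, norm_mul, norm_inv,
    Complex.norm_real, Real.norm_of_nonneg hp.le, norm_mul, Pi.star_apply, norm_star,
    inv_mul_le_iff₀ hp]
  nlinarith [h1 a, h1 b, sq_nonneg (‖affineVec s z a‖ - ‖affineVec s z b‖)]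

/-! ### Averages of the moment map -/

lemma integrable_mul_momentMap {k : ℕ} (s : SectionBasis k) {h : ℂ → ℝ} (hc : Continuous h) {C : ℝ}
    (hC : ∀ z, |h z| ≤ C) (a b : Fin (k + 1)) :
    Integrable fun z => fsDensity z • ((h z : ℂ) * momentMap (embedding s (chart 0 z)) a b) := by
  refine integrable_fsDensity.smul_bdd C (Continuous.aestronglyMeasurable ?_)
    (Filter.Eventually.of_forall fun z => ?_)
  · exact (Complex.continuous_ofReal.comp hc).mul
      ((continuous_momentMap_chart s 0).matrix_elem a b)
  · rw [norm_mul, Complex.norm_real]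
    calc _ ≤ C * 1 := mul_le_mul (hC z) (norm_momentMap_chart_le s z a b) (norm_nonneg _)
          ((abs_nonneg _).trans (hC z))
      _ = C := mul_one C

lemma fsDensity_smul_trace {k : ℕ} (s : SectionBasis k) (h : ℂ → ℝ)
    (A : Matrix (Fin (k + 1)) (Fin (k + 1)) ℂ) (z : ℂ) :
    fsDensity z • ((h z : ℂ) * (A * momentMap (embedding s (chart 0 z))).trace) =
      ∑ a, ∑ b, A a b *
        (fsDensity z • ((h z : ℂ) * momentMap (embedding s (chart 0 z)) b a)) := by
  simp only [Matrix.trace, Matrix.diag, Matrix.mul_apply, Finset.mul_sum, Finset.smul_sum,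
    Complex.real_smul]
  exact Finset.sum_congr rfl fun a _ => Finset.sum_congr rfl fun b _ => by ring

lemma integrable_mul_trace {k : ℕ} (s : SectionBasis k) {h : ℂ → ℝ} (hc : Continuous h) {C : ℝ}
    (hC : ∀ z, |h z| ≤ C) (A : Matrix (Fin (k + 1)) (Fin (k + 1)) ℂ) :
    Integrable fun z =>
      fsDensity z • ((h z : ℂ) * (A * momentMap (embedding s (chart 0 z))).trace) := by
  simp only [fsDensity_smul_trace]
  exact integrable_finsetSum _ fun a _ => integrable_finsetSum _ fun b _ =>
    (integrable_mul_momentMap s hc hC b a).const_mul _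

/-- The matrix `∫ h μ ω`, for a function `h` on the affine chart. -/
def weightedMoment {k : ℕ} (s : SectionBasis k) (h : ℂ → ℝ) :
    Matrix (Fin (k + 1)) (Fin (k + 1)) ℂ :=
  Matrix.of fun a b => ∫ z, fsDensity z • ((h z : ℂ) * momentMap (embedding s (chart 0 z)) a b)

lemma trace_mul_weightedMoment {k : ℕ} (s : SectionBasis k) {h : ℂ → ℝ} (hc : Continuous h) {C : ℝ}
    (hC : ∀ z, |h z| ≤ C) (A : Matrix (Fin (k + 1)) (Fin (k + 1)) ℂ) :
    (A * weightedMoment s h).trace =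
      ∫ z, fsDensity z • ((h z : ℂ) * (A * momentMap (embedding s (chart 0 z))).trace) := by
  simp only [fsDensity_smul_trace]
  have hi := fun b a => integrable_mul_momentMap s hc hC b a
  refine Eq.trans ?_ (integral_finsetSum _ fun a _ => integrable_finsetSum _ fun b _ =>
    (hi b a).const_mul _).symm
  simp only [Matrix.trace, Matrix.diag, Matrix.mul_apply, weightedMoment, Matrix.of_apply]
  refine Finset.sum_congr rfl fun a _ => ?_
  refine Eq.trans ?_ (integral_finsetSum _ fun b _ => (hi b a).const_mul _).symm
  exact Finset.sum_congr rfl fun b _ => (integral_const_mul _ _).symm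

lemma meanMoment_eq_weightedMoment {k : ℕ} (s : SectionBasis k) :
    meanMoment s = weightedMoment s fun _ => 1 := by
  ext a b
  simp [meanMoment, weightedMoment, fsIntegral]

lemma trace_mul_meanMoment {k : ℕ} (s : SectionBasis k)
    (A : Matrix (Fin (k + 1)) (Fin (k + 1)) ℂ) :
    (A * meanMoment s).trace =
      ∫ z, fsDensity z • (A * momentMap (embedding s (chart 0 z))).trace := by
  rw [meanMoment_eq_weightedMoment, trace_mul_weightedMoment s continuous_const (C := 1) (by simp)]
  simp

lemma trace_meanMoment {k : ℕ} (s : SectionBasis k) : (meanMoment s).trace = 1 := by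
  have h : ∀ z, fsDensity z •
      ((1 : Matrix (Fin (k + 1)) (Fin (k + 1)) ℂ) * momentMap (embedding s (chart 0 z))).trace =
      ((fsDensity z : ℝ) : ℂ) := fun z => by
    have : ((normSq (affineVec s z) : ℝ) : ℂ) ≠ 0 :=
      Complex.ofReal_ne_zero.2 (normSq_affineVec_pos s z).ne'
    rw [trace_mul_momentMap_chart, Matrix.one_mulVec, star_dotProduct_self, div_self this]
    simp
  have h1 := integral_fsDensity_pow 0
  rw [← Matrix.one_mul (meanMoment s), trace_mul_meanMoment]
  simp only [h]
  rw [integral_complex_ofReal]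
  simp at h1
  rw [h1]
  simp

lemma IsBalanced.meanMoment_eq {k : ℕ} {s : SectionBasis k} (hs : IsBalanced s) :
    meanMoment s = (1 / ((k : ℂ) + 1)) • 1 := by
  rw [IsBalanced, trace_meanMoment, sub_eq_zero] at hs
  exact hs

theorem isBalanced_binomialBasis (k : ℕ) : IsBalanced (binomialBasis k) := by
  have key : meanMoment (binomialBasis k) = (1 / ((k : ℂ) + 1)) • 1 := by
    ext a b
    have hab : meanMoment (binomialBasis k) a b = ∫ z, fsDensity z •
        (coherent k z a * star (coherent k z b) / (((1 + ‖z‖ ^ 2) ^ k : ℝ) : ℂ)) := by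
      simp only [meanMoment, fsIntegral, Matrix.of_apply, momentMap_chart, affineVec_binomialBasis,
        normSq_coherent, Matrix.smul_apply, vecMulVec_apply, Pi.star_apply, smul_eq_mul]
      simp only [div_eq_inv_mul]
    have ha := a.2
    have hb := b.2
    rw [hab]
    rcases eq_or_ne a b with rfl | hne
    · have h1 : ∀ z, fsDensity z •
          (coherent k z a * star (coherent k z a) / (((1 + ‖z‖ ^ 2) ^ k : ℝ) : ℂ)) =
          (((k.choose a : ℝ) * (fsDensity z * ((1 / (1 + ‖z‖ ^ 2)) ^ (a : ℕ) *
            (‖z‖ ^ 2 / (1 + ‖z‖ ^ 2)) ^ (k - a : ℕ))) : ℝ) : ℂ) := by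
        intro z
        rw [mul_star_eq, ← Complex.ofReal_div, Complex.real_smul, ← Complex.ofReal_mul]
        congr 1
        have h2 : ‖coherent k z a‖ ^ 2 = (k.choose a : ℝ) * (‖z‖ ^ 2) ^ (k - a : ℕ) := by
          rw [coherent, norm_mul, mul_pow, Complex.norm_real, Real.norm_of_nonneg
            (Real.sqrt_nonneg _), Real.sq_sqrt (by positivity), norm_pow]
          ring
        have h3 : (1 + ‖z‖ ^ 2) ^ k = (1 + ‖z‖ ^ 2) ^ (a : ℕ) * (1 + ‖z‖ ^ 2) ^ (k - a : ℕ) := by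
          rw [← pow_add]; congr 1; omega
        rw [h2, h3, div_pow, div_pow, one_pow]
        field_simp
      simp only [h1]
      rw [integral_complex_ofReal, integral_const_mul, integral_beta, betaCoeff,
        Nat.add_sub_cancel' (Nat.lt_succ_iff.1 ha), Nat.factorial_succ]
      have h4 := Nat.choose_mul_factorial_mul_factorial (Nat.lt_succ_iff.1 ha)
      have h5 : (k.choose a : ℝ) * (((a : ℕ).factorial : ℝ) * ((k - a : ℕ).factorial : ℝ)) =
          k.factorial := by rw [← h4]; push_cast; ring
      rw [mul_div_assoc', h5]
      have : (k.factorial : ℝ) ≠ 0 := by positivity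
      push_cast
      rw [div_mul_cancel_right₀ (by exact_mod_cast this)]
      simp
    · -- The rotation by `ζ` multiplies the integrand by a number different from `1`.
      rw [Matrix.smul_apply, Matrix.one_apply_ne hne, smul_zero]
      have hζ := Complex.isPrimitiveRoot_exp (k + 1) (Nat.succ_ne_zero k)
      set ζ := Complex.exp (2 * Real.pi * Complex.I / ((k + 1 : ℕ) : ℂ))
      have hζn : ‖ζ‖ = 1 := hζ.norm'_eq_one (Nat.succ_ne_zero k)
      have h1 := integral_fsDensity_comp_moebius (w := 0) hζn fun z =>
        coherent k z a * star (coherent k z b) / (((1 + ‖z‖ ^ 2) ^ k : ℝ) : ℂ)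
      have h2 : ∀ z, fsDensity z • (coherent k (moebius 0 ζ z) a *
          star (coherent k (moebius 0 ζ z) b) / (((1 + ‖moebius 0 ζ z‖ ^ 2) ^ k : ℝ) : ℂ)) =
          (ζ ^ (k - a : ℕ) * star ζ ^ (k - b : ℕ)) * (fsDensity z •
            (coherent k z a * star (coherent k z b) / (((1 + ‖z‖ ^ 2) ^ k : ℝ) : ℂ))) := by
        intro z
        have h3 : moebius 0 ζ z = ζ * z := by simp [moebius]
        rw [h3, norm_mul, hζn, one_mul]
        simp only [coherent, mul_pow, star_mul', star_pow, Complex.real_smul]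
        ring
      simp only [h2] at h1
      rw [integral_const_mul] at h1
      have h4 := pow_mul_star_pow_ne_one (Nat.succ_ne_zero k) hζ (c := k - a) (d := k - b)
        (by omega) (by omega) (fun h => hne (Fin.ext (by omega)))
      have h5 := sub_ne_zero.2 h4
      refine (mul_eq_zero.1 ?_).resolve_left h5
      rw [sub_mul, one_mul, h1, sub_self]
  rw [IsBalanced, trace_meanMoment, key, sub_self]

/-! ### Uniqueness of balanced bases -/

/-- The matrix expressing the basis `s` in terms of the binomial basis. -/
def transition {k : ℕ} (s : SectionBasis k) : Matrix (Fin (k + 1)) (Fin (k + 1)) ℂ :=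
  Matrix.of fun j l => (binomialBasis k).repr (s j) l

lemma affineVec_eq_transition {k : ℕ} (s : SectionBasis k) (z : ℂ) :
    affineVec s z = transition s *ᵥ coherent k z := by
  rw [← affineVec_binomialBasis]
  ext j
  have h := (binomialBasis k).sum_repr (s j)
  simp only [affineVec, sectionVec]
  rw [← h]
  simp only [Submodule.coe_sum, Submodule.coe_smul, map_sum, MvPolynomial.smul_eval]
  rfl

lemma continuous_coherent (k : ℕ) : Continuous (coherent k) :=
  continuous_pi fun j => by unfold coherent; fun_prop

lemma continuous_normSq {n : Type*} [Fintype n] : Continuous (normSq : (n → ℂ) → ℝ) := by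
  unfold normSq
  fun_prop

/-- The defect in the Cauchy-Schwarz inequality `|⟨v, Hv⟩|² ≤ |v|² |Hv|²` for `H = gᴴ g`, written as
the square of a vector that measures the failure of `v` to be an eigenvector of `H`. -/
lemma normSq_smul_sub {n : Type*} [Fintype n] (g : Matrix n n ℂ) (v : n → ℂ) :
    normSq ((normSq v : ℂ) • (gᴴ *ᵥ (g *ᵥ v)) - (normSq (g *ᵥ v) : ℂ) • v) =
      normSq v * (normSq v * normSq (gᴴ *ᵥ (g *ᵥ v)) - normSq (g *ᵥ v) ^ 2) := by
  apply Complex.ofReal_injective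
  have h1 : star v ⬝ᵥ (gᴴ *ᵥ (g *ᵥ v)) = (normSq (g *ᵥ v) : ℂ) := by
    rw [← star_mulVec_dotProduct, star_dotProduct_self]
  have h2 : star (gᴴ *ᵥ (g *ᵥ v)) ⬝ᵥ v = (normSq (g *ᵥ v) : ℂ) := by
    rw [star_mulVec_dotProduct, conjTranspose_conjTranspose, star_dotProduct_self]
  rw [← star_dotProduct_self]
  simp only [star_sub, star_smul, sub_dotProduct, dotProduct_sub, smul_dotProduct, dotProduct_smul,
    h1, h2, star_dotProduct_self, smul_eq_mul, Complex.star_def, Complex.conj_ofReal]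
  push_cast
  ring

/-- A balanced basis differs from the binomial basis by a multiple of a unitary matrix.
Let `H = gᴴ g`, where `g` is the transition matrix, and let `v` be the coherent state at `z`. That
`s` and the binomial basis are both balanced gives `∫ |Hv|² / |gv|² ω = tr H / (k + 1)` and
`∫ |gv|² / |v|² ω = tr H / (k + 1)`. The difference of the integrands is nonnegative by
Cauchy-Schwarz, so it vanishes and every coherent state is an eigenvector of `H`; hence `H` is
scalar. -/
theorem IsBalanced.transition_unitary {k : ℕ} {s : SectionBasis k} (hs : IsBalanced s) :
    ∃ r : ℝ, 0 < r ∧ (transition s)ᴴ * transition s = (r : ℂ) • 1 := by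
  set g := transition s with hg
  have hpos : ∀ z, 0 < normSq (g *ᵥ coherent k z) := fun z => by
    rw [hg, ← affineVec_eq_transition]; exact normSq_affineVec_pos s z
  have hpos0 : ∀ z, 0 < normSq (coherent k z) := fun z => by
    rw [normSq_coherent]; positivity
  have e1 : ∀ z, fsDensity z • (g * gᴴ * momentMap (embedding s (chart 0 z))).trace =
      ((fsDensity z *
        (normSq (gᴴ *ᵥ (g *ᵥ coherent k z)) / normSq (g *ᵥ coherent k z)) : ℝ) : ℂ) := by
    intro z
    rw [trace_mul_momentMap_chart, affineVec_eq_transition, ← hg, ← mulVec_mulVec]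
    nth_rewrite 2 [← conjTranspose_conjTranspose g]
    rw [← star_mulVec_dotProduct, star_dotProduct_self, Complex.real_smul]
    push_cast
    rfl
  have e2 : ∀ z, fsDensity z •
      (gᴴ * g * momentMap (embedding (binomialBasis k) (chart 0 z))).trace =
      ((fsDensity z * (normSq (g *ᵥ coherent k z) / normSq (coherent k z)) : ℝ) : ℂ) := by
    intro z
    rw [trace_mul_momentMap_chart, affineVec_binomialBasis, ← mulVec_mulVec,
      ← star_mulVec_dotProduct, star_dotProduct_self, Complex.real_smul]
    push_cast
    rfl
  have hmean : (g * gᴴ * meanMoment s).trace =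
      (gᴴ * g * meanMoment (binomialBasis k)).trace := by
    rw [hs.meanMoment_eq, (isBalanced_binomialBasis k).meanMoment_eq, Matrix.mul_smul,
      Matrix.mul_smul, Matrix.mul_one, Matrix.mul_one, Matrix.trace_smul, Matrix.trace_smul,
      Matrix.trace_mul_comm]
  rw [trace_mul_meanMoment, trace_mul_meanMoment] at hmean
  simp only [e1, e2] at hmean
  rw [integral_complex_ofReal, integral_complex_ofReal, Complex.ofReal_inj] at hmean
  have i1 : Integrable fun z => fsDensity z *
      (normSq (gᴴ *ᵥ (g *ᵥ coherent k z)) / normSq (g *ᵥ coherent k z)) := by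
    have h := integrable_mul_trace s (h := fun _ => 1) continuous_const (C := 1) (by simp) (g * gᴴ)
    simp only [Complex.ofReal_one, one_mul, e1] at h
    exact h.re
  have i2 : Integrable fun z => fsDensity z *
      (normSq (g *ᵥ coherent k z) / normSq (coherent k z)) := by
    have h := integrable_mul_trace (binomialBasis k) (h := fun _ => 1) continuous_const (C := 1)
      (by simp) (gᴴ * g)
    simp only [Complex.ofReal_one, one_mul, e2] at h
    exact h.re
  have hdiff : ∀ z, fsDensity z *
      (normSq (gᴴ *ᵥ (g *ᵥ coherent k z)) / normSq (g *ᵥ coherent k z)) -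
      fsDensity z * (normSq (g *ᵥ coherent k z) / normSq (coherent k z)) =
      fsDensity z * (normSq ((normSq (coherent k z) : ℂ) • (gᴴ *ᵥ (g *ᵥ coherent k z)) -
        (normSq (g *ᵥ coherent k z) : ℂ) • coherent k z) /
        (normSq (coherent k z) ^ 2 * normSq (g *ᵥ coherent k z))) := by
    intro z
    have h1 := (hpos z).ne'
    have h2 := (hpos0 z).ne'
    rw [normSq_smul_sub]
    field_simp
  have hint : ∫ z, (fsDensity z *
      (normSq (gᴴ *ᵥ (g *ᵥ coherent k z)) / normSq (g *ᵥ coherent k z)) -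
      fsDensity z * (normSq (g *ᵥ coherent k z) / normSq (coherent k z))) = 0 := by
    rw [integral_sub i1 i2, hmean, sub_self]
  have hdens : ∀ z, 0 < fsDensity z := fun z => by unfold fsDensity; positivity
  have hcd : Continuous fsDensity := by
    unfold fsDensity
    exact continuous_const.div (by fun_prop) fun z => by positivity
  have hz : (fun z => fsDensity z *
      (normSq (gᴴ *ᵥ (g *ᵥ coherent k z)) / normSq (g *ᵥ coherent k z)) -
      fsDensity z * (normSq (g *ᵥ coherent k z) / normSq (coherent k z))) = fun _ => 0 := by
    refine (Continuous.ae_eq_iff_eq volume ?_ continuous_const).1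
      ((integral_eq_zero_iff_of_nonneg (fun z => ?_) (i1.sub i2)).1 hint)
    · have c0 := continuous_coherent k
      have c1 : Continuous fun z => g *ᵥ coherent k z := continuous_const.matrix_mulVec c0
      have c2 : Continuous fun z => gᴴ *ᵥ (g *ᵥ coherent k z) := continuous_const.matrix_mulVec c1
      exact (hcd.mul ((continuous_normSq.comp c2).div (continuous_normSq.comp c1)
        fun z => (hpos z).ne')).sub (hcd.mul ((continuous_normSq.comp c1).div
          (continuous_normSq.comp c0) fun z => (hpos0 z).ne'))
    · refine le_of_le_of_eq ?_ (hdiff z).symm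
      exact mul_nonneg (hdens z).le (div_nonneg (normSq_nonneg _)
        (mul_nonneg (sq_nonneg _) (normSq_nonneg _)))
  have heig : ∀ z, (gᴴ * g) *ᵥ coherent k z =
      ((normSq (g *ᵥ coherent k z) / normSq (coherent k z) : ℝ) : ℂ) • coherent k z := by
    intro z
    have h := congrFun hz z
    simp only [hdiff] at h
    have h1 := (div_eq_zero_iff.1 ((mul_eq_zero.1 h).resolve_left (hdens z).ne')).resolve_right
      (mul_pos (pow_pos (hpos0 z) 2) (hpos z)).ne'
    rw [normSq_eq_zero, sub_eq_zero] at h1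
    have h2 : (normSq (coherent k z) : ℂ) ≠ 0 := Complex.ofReal_ne_zero.2 (hpos0 z).ne'
    rw [← mulVec_mulVec, Complex.ofReal_div, div_eq_inv_mul, mul_smul, ← h1, inv_smul_smul₀ h2]
  -- `Hv = cv` with `c` real makes the expectation of `[X, H]` in the state `v` zero.
  have hcomm : ∀ X : Matrix (Fin (k + 1)) (Fin (k + 1)) ℂ, Commute X (gᴴ * g) := by
    intro X
    have : X * (gᴴ * g) - (gᴴ * g) * X = 0 := by
      refine eq_zero_of_coherent_dotProduct fun z => ?_
      have hH : (gᴴ * g)ᴴ = gᴴ * g := by rw [conjTranspose_mul, conjTranspose_conjTranspose]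
      rw [sub_mulVec, dotProduct_sub, ← mulVec_mulVec _ X, ← mulVec_mulVec _ _ X]
      nth_rewrite 2 [← hH]
      rw [← star_mulVec_dotProduct, heig]
      simp [mulVec_smul]
    exact sub_eq_zero.1 this
  obtain ⟨c, hc⟩ := Matrix.mem_range_scalar_iff_commute_single.2 fun i j _ =>
    hcomm (Matrix.single i j 1)
  refine ⟨normSq (g *ᵥ coherent k 0) / normSq (coherent k 0), div_pos (hpos 0) (hpos0 0), ?_⟩
  have h0 := heig 0
  have hne : coherent k 0 ≠ 0 := fun h => (hpos0 0).ne' (normSq_eq_zero.2 h)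
  have hc' : c • (1 : Matrix (Fin (k + 1)) (Fin (k + 1)) ℂ) = gᴴ * g := by
    rw [← hc, Matrix.scalar_apply, smul_one_eq_diagonal]
  rw [← hc', smul_mulVec, one_mulVec] at h0
  rw [← hc', smul_left_injective ℂ hne h0]

/-! ### The operator `P*P` on eigenmatrices -/

lemma dotProduct_affineVec {k : ℕ} {s : SectionBasis k} {r : ℝ}
    (hg : (transition s)ᴴ * transition s = (r : ℂ) • 1) (w z : ℂ) :
    star (affineVec s w) ⬝ᵥ affineVec s z = r * (1 + star w * z) ^ k := by
  rw [affineVec_eq_transition, affineVec_eq_transition, star_mulVec_dotProduct, mulVec_mulVec, hg,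
    smul_mulVec, one_mulVec, dotProduct_smul, star_coherent_dotProduct, smul_eq_mul]

lemma normSq_affineVec {k : ℕ} {s : SectionBasis k} {r : ℝ}
    (hg : (transition s)ᴴ * transition s = (r : ℂ) • 1) (z : ℂ) :
    normSq (affineVec s z) = r * (1 + ‖z‖ ^ 2) ^ k := by
  apply Complex.ofReal_injective
  rw [← star_dotProduct_self, dotProduct_affineVec hg, mul_comm (star z), mul_star_eq]
  push_cast
  rfl

/-- For a balanced embedding the kernel `tr (μ(w) μ(z))` does not depend on the basis. -/
lemma trace_momentMap_mul_momentMap {k : ℕ} {s : SectionBasis k} {r : ℝ} (hr : 0 < r)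
    (hg : (transition s)ᴴ * transition s = (r : ℂ) • 1) (w z : ℂ) :
    (momentMap (embedding s (chart 0 w)) * momentMap (embedding s (chart 0 z))).trace =
      ((overlap w z ^ k : ℝ) : ℂ) := by
  have e : (1 + star z * w) = star (1 + star w * z) := by
    simp [mul_comm]
  rw [trace_mul_momentMap_chart, momentMap_chart, smul_mulVec, vecMulVec_mulVec, dotProduct_smul,
    dotProduct_smul, dotProduct_affineVec hg, dotProduct_affineVec hg, normSq_affineVec hg,
    normSq_affineVec hg, overlap, smul_eq_mul, MulOpposite.smul_eq_mul_unop, MulOpposite.unop_op, e]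
  have h1 : (r : ℂ) * star (1 + star w * z) ^ k * (r * (1 + star w * z) ^ k) =
      (r : ℂ) ^ 2 * ((‖1 + star w * z‖ ^ 2 : ℝ) : ℂ) ^ k := by
    rw [← mul_star_eq, mul_pow]; ring
  have hw : 1 + ‖w‖ ^ 2 ≠ 0 := by positivity
  have hz : 1 + ‖z‖ ^ 2 ≠ 0 := by positivity
  rw [h1, ← Complex.ofReal_pow, ← Complex.ofReal_pow, ← Complex.ofReal_inv, ← Complex.ofReal_mul,
    ← Complex.ofReal_mul, ← Complex.ofReal_div, div_pow, mul_pow]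
  congr 1
  field_simp

/-- A matrix is determined by its Hamiltonian. -/
lemma eq_zero_of_trace_mul_momentMap {k : ℕ} {s : SectionBasis k} {r : ℝ} (hr : 0 < r)
    (hg : (transition s)ᴴ * transition s = (r : ℂ) • 1)
    {A : Matrix (Fin (k + 1)) (Fin (k + 1)) ℂ}
    (h : ∀ z, (A * momentMap (embedding s (chart 0 z))).trace = 0) : A = 0 := by
  set g := transition s with hgdef
  have hr' : (r : ℂ) ≠ 0 := Complex.ofReal_ne_zero.2 hr.ne'
  have h1 : gᴴ * A * g = 0 := by
    refine eq_zero_of_coherent_dotProduct fun z => ?_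
    have hz := h z
    rw [trace_mul_momentMap_chart, div_eq_zero_iff] at hz
    have := hz.resolve_right (Complex.ofReal_ne_zero.2 (normSq_affineVec_pos s z).ne')
    rwa [affineVec_eq_transition, star_mulVec_dotProduct, mulVec_mulVec, mulVec_mulVec]
      at this
  have h2 : ((r : ℂ)⁻¹ • gᴴ) * g = 1 := by
    rw [Matrix.smul_mul, hg, inv_smul_smul₀ hr']
  have h3 : g * gᴴ = (r : ℂ) • 1 := by
    have := mul_eq_one_comm.1 h2
    rw [Matrix.mul_smul] at this
    rw [← this, smul_inv_smul₀ hr']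
  have h4 : g * (gᴴ * A * g) * gᴴ = (r : ℂ) ^ 2 • A := by
    calc g * (gᴴ * A * g) * gᴴ = (g * gᴴ) * A * (g * gᴴ) := by simp only [Matrix.mul_assoc]
      _ = _ := by
        rw [h3, Matrix.smul_mul, Matrix.one_mul, Matrix.smul_mul, Matrix.mul_smul, Matrix.mul_one,
          smul_smul, pow_two]
  rw [h1, Matrix.mul_zero, Matrix.zero_mul] at h4
  exact (smul_eq_zero.1 h4.symm).resolve_left (pow_ne_zero 2 hr')

lemma ofReal_hamiltonian_chart {k : ℕ} (s : SectionBasis k) (B : Herm k) (z : ℂ) :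
    (hamiltonian s B (chart 0 z) : ℂ) = ((B : Matrix (Fin (k + 1)) (Fin (k + 1)) ℂ) *
      momentMap (embedding s (chart 0 z))).trace := by
  have hB : (B : Matrix (Fin (k + 1)) (Fin (k + 1)) ℂ)ᴴ = B := B.2
  rw [hamiltonian, ← Complex.conj_eq_iff_re, trace_mul_momentMap_chart]
  have : star (star (affineVec s z) ⬝ᵥ
      ((B : Matrix (Fin (k + 1)) (Fin (k + 1)) ℂ) *ᵥ affineVec s z)) =
      star (affineVec s z) ⬝ᵥ ((B : Matrix (Fin (k + 1)) (Fin (k + 1)) ℂ) *ᵥ affineVec s z) := by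
    rw [← star_dotProduct, star_mulVec_dotProduct, hB]
  rw [map_div₀, Complex.conj_ofReal]
  congr 1

lemma isFormQuotient_hamiltonian {k : ℕ} {s : SectionBasis k} {r : ℝ}
    (hg : (transition s)ᴴ * transition s = (r : ℂ) • 1) (B : Herm k) :
    IsFormQuotient k (fun j : Fin (k + 1) => k - (j : ℕ)) (fun a b =>
      ((transition s)ᴴ * (B : Matrix (Fin (k + 1)) (Fin (k + 1)) ℂ) * transition s) b a *
        (((Real.sqrt (k.choose a) : ℝ) : ℂ) * ((Real.sqrt (k.choose b) : ℝ) : ℂ)) / r)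
      (fun z => hamiltonian s B (chart 0 z)) := by
  intro z
  rw [ofReal_hamiltonian_chart, trace_mul_momentMap_chart, normSq_affineVec hg,
    affineVec_eq_transition, star_mulVec_dotProduct, mulVec_mulVec, mulVec_mulVec,
    Complex.ofReal_mul, Complex.ofReal_pow, ← div_div]
  congr 1
  rw [dotProduct, Finset.sum_div, Finset.sum_comm]
  refine Finset.sum_congr rfl fun b _ => ?_
  rw [mulVec, dotProduct, Finset.mul_sum, Finset.sum_div]
  refine Finset.sum_congr rfl fun a _ => ?_
  simp only [coherent, Pi.star_apply, star_mul', Complex.star_def, Complex.conj_ofReal]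
  ring

lemma laplacian_hamiltonian {k : ℕ} {s : SectionBasis k} {i : ℕ} {B : Herm k} (hB : B ∈ U s i)
    (z : ℂ) : Δ (fun w => hamiltonian s B (chart 0 w)) z =
      -(4 * (i * (i + 1)) / (1 + ‖z‖ ^ 2) ^ 2) * hamiltonian s B (chart 0 z) := by
  have h := hB.2 0 z
  rw [fsLaplacian, eigenvalue, fsDensity] at h
  have hz : 1 + ‖z‖ ^ 2 ≠ 0 := by positivity
  have hpi := Real.pi_ne_zero
  field_simp at h ⊢
  linear_combination -h

/-- Quantizing the Hamiltonian of `B ∈ U s i` returns a multiple of `B`: both sides have the same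
Hamiltonian by the Funk-Hecke formula. -/
theorem IsBalanced.weightedMoment_hamiltonian {k : ℕ} {s : SectionBasis k} (hs : IsBalanced s)
    {i : ℕ} {B : Herm k} (hB : B ∈ U s i) :
    weightedMoment s (fun z => hamiltonian s B (chart 0 z)) =
      (funkHecke k i : ℂ) • (B : Matrix (Fin (k + 1)) (Fin (k + 1)) ℂ) := by
  obtain ⟨r, hr, hg⟩ := hs.transition_unitary
  have hF := isFormQuotient_hamiltonian hg B
  have hsm : ContDiff ℝ 2 fun z => hamiltonian s B (chart 0 z) :=
    contDiff_infty.1 (hB.1 0) 2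
  have he : ∀ j : Fin (k + 1), k - (j : ℕ) ≤ k := fun j => Nat.sub_le _ _
  refine sub_eq_zero.1 (eq_zero_of_trace_mul_momentMap hr hg fun w => ?_)
  have h := hF.integral_overlap he hsm (laplacian_hamiltonian hB) w
  rw [Matrix.sub_mul, Matrix.trace_sub, Matrix.smul_mul, Matrix.trace_smul,
    ← ofReal_hamiltonian_chart, Matrix.trace_mul_comm,
    trace_mul_weightedMoment s hsm.continuous (hF.abs_le he), sub_eq_zero]
  simp only [trace_momentMap_mul_momentMap hr hg]
  rw [smul_eq_mul, ← Complex.ofReal_mul, ← h, ← integral_complex_ofReal]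
  congr 1
  ext z
  rw [Complex.real_smul]
  push_cast
  rfl

theorem IsBalanced.l2Inner_opP {k : ℕ} {s : SectionBasis k} (hs : IsBalanced s)
    {i : ℕ} (A : Herm k) {B : Herm k} (hB : B ∈ U s i) :
    ((l2Inner s (opP s A) (opP s B) : ℝ) : ℂ) = ((1 / (k + 1) - funkHecke k i : ℝ) : ℂ) *
      ((A : Matrix (Fin (k + 1)) (Fin (k + 1)) ℂ) * (B : Matrix _ _ ℂ)).trace := by
  obtain ⟨r, hr, hg⟩ := hs.transition_unitary
  have hF := isFormQuotient_hamiltonian hg B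
  have hsm : ContDiff ℝ 2 fun z => hamiltonian s B (chart 0 z) :=
    contDiff_infty.1 (hB.1 0) 2
  have he : ∀ j : Fin (k + 1), k - (j : ℕ) ≤ k := fun j => Nat.sub_le _ _
  have i1 := integrable_mul_trace s (h := fun _ => 1) continuous_const (C := 1) (by simp)
    ((A : Matrix (Fin (k + 1)) (Fin (k + 1)) ℂ) * (B : Matrix _ _ ℂ))
  have i2 := integrable_mul_trace s hsm.continuous (hF.abs_le he)
    (A : Matrix (Fin (k + 1)) (Fin (k + 1)) ℂ)
  simp only [Complex.ofReal_one, one_mul] at i1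
  have e1 := trace_mul_meanMoment s
    ((A : Matrix (Fin (k + 1)) (Fin (k + 1)) ℂ) * (B : Matrix _ _ ℂ))
  have e2 := trace_mul_weightedMoment s hsm.continuous (hF.abs_le he)
    (A : Matrix (Fin (k + 1)) (Fin (k + 1)) ℂ)
  have key : l2Inner s (opP s A) (opP s B) = (∫ z, (fsDensity z •
      ((A : Matrix (Fin (k + 1)) (Fin (k + 1)) ℂ) * (B : Matrix _ _ ℂ) *
        momentMap (embedding s (chart 0 z))).trace - fsDensity z •
          ((hamiltonian s B (chart 0 z) : ℂ) * ((A : Matrix (Fin (k + 1)) (Fin (k + 1)) ℂ) *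
            momentMap (embedding s (chart 0 z))).trace))).re := by
    rw [← RCLike.re_eq_complex_re]
    refine Eq.trans ?_ (integral_re (i1.sub i2))
    rw [l2Inner, fsIntegral]
    congr 1
    ext z
    rw [opP, opP, fsMetric_vectorField, ofReal_hamiltonian_chart, RCLike.re_eq_complex_re]
    rw [← smul_sub, Complex.smul_re, mul_comm (Matrix.trace (_ * momentMap _))]
  rw [integral_sub i1 i2, ← e1, ← e2, hs.meanMoment_eq, hs.weightedMoment_hamiltonian hB] at key
  rw [key, ← trace_herm_mul_re A B, ← Complex.ofReal_mul]
  congr 1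
  have h1 : ((1 / ((k : ℂ) + 1))) = ((1 / ((k : ℝ) + 1) : ℝ) : ℂ) := by push_cast; rfl
  rw [h1, Matrix.mul_smul, Matrix.mul_one, Matrix.mul_smul, Matrix.trace_smul, Matrix.trace_smul,
    smul_eq_mul, smul_eq_mul, ← sub_mul, ← Complex.ofReal_sub, Complex.re_ofReal_mul]

theorem IsBalanced.opPStarP_eq {k : ℕ} {s : SectionBasis k} (hs : IsBalanced s)
    {i : ℕ} {B : Herm k} (hB : B ∈ U s i) :
    opPStarP s B = (1 / (k + 1) - funkHecke k i : ℝ) • B := by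
  refine herm_ext fun A => ?_
  rw [trace_mul_opPStarP, hs.l2Inner_opP A hB, selfAdjoint.val_smul, Matrix.mul_smul,
    Matrix.trace_smul, Complex.real_smul]

/-! ### Asymptotics of the eigenvalue -/

lemma betaCoeff_le {k : ℕ} (hk : 1 ≤ k) (n : ℕ) :
    betaCoeff k (n + 2) ≤ (n + 2).factorial / (k : ℝ) ^ 3 := by
  have h1 : k.factorial * k ^ 3 ≤ (k + (n + 2) + 1).factorial := by
    have h2 : k.factorial * (k + 1) ^ (n + 3) ≤ (k + (n + 3)).factorial :=
      Nat.factorial_mul_pow_le_factorial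
    have h3 : k ^ 3 ≤ (k + 1) ^ (n + 3) :=
      (Nat.pow_le_pow_left (Nat.le_succ k) 3).trans
        (Nat.pow_le_pow_right (Nat.succ_pos k) (by omega))
    exact (Nat.mul_le_mul_left _ h3).trans h2
  have hk0 : (0 : ℝ) < k := by exact_mod_cast hk
  have h4 : (k.factorial : ℝ) * (k : ℝ) ^ 3 ≤ (k + (n + 2) + 1).factorial := by exact_mod_cast h1
  rw [betaCoeff, div_le_div_iff₀ (by positivity) (by positivity)]
  calc (k.factorial : ℝ) * (n + 2).factorial * (k : ℝ) ^ 3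
      = (n + 2).factorial * (k.factorial * (k : ℝ) ^ 3) := by ring
    _ ≤ _ := mul_le_mul_of_nonneg_left h4 (by positivity)

/-- In `1 / (k + 1) - funkHecke k i` the term `n = 0` cancels, the term `n = 1` is
`i (i + 1) / ((k + 1) (k + 2))`, and the remaining terms are `O(k⁻³)`. -/
theorem exists_funkHecke_asymptotic (i : ℕ) : ∃ K : ℝ, ∀ k : ℕ, 1 ≤ k →
    |(1 / (k + 1) - funkHecke k i : ℝ) - 4 * Real.pi * i * (i + 1) / (4 * Real.pi * (k : ℝ) ^ 2)| ≤
      K / (k : ℝ) ^ 3 := by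
  refine ⟨3 * (i * (i + 1)) +
    ∑ n ∈ Finset.range i, |legendreCoeff i (n + 2)| * (n + 2).factorial, fun k hk => ?_⟩
  have hk0 : (0 : ℝ) < k := by exact_mod_cast hk
  have hb1 : betaCoeff k 1 = 1 / ((k + 1) * (k + 2)) := by
    rw [betaCoeff_succ, betaCoeff_zero, betaCoeff_zero]
    push_cast
    field_simp
    ring
  have h1 : (1 / (k + 1) - funkHecke k i : ℝ) -
      4 * Real.pi * i * (i + 1) / (4 * Real.pi * (k : ℝ) ^ 2) =
      -(i * (i + 1) * ((3 * k + 2) / ((k : ℝ) ^ 2 * ((k + 1) * (k + 2))))) -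
        ∑ n ∈ Finset.range i, legendreCoeff i (n + 2) * betaCoeff k (n + 2) := by
    rw [funkHecke, Finset.sum_range_succ', Finset.sum_range_succ', betaCoeff_zero, hb1]
    have hpi := Real.pi_ne_zero
    simp only [legendreCoeff]
    push_cast
    field_simp
    ring
  have h2 : |∑ n ∈ Finset.range i, legendreCoeff i (n + 2) * betaCoeff k (n + 2)| ≤
      (∑ n ∈ Finset.range i, |legendreCoeff i (n + 2)| * (n + 2).factorial) / (k : ℝ) ^ 3 := by
    refine (Finset.abs_sum_le_sum_abs _ _).trans ?_
    rw [Finset.sum_div]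
    refine Finset.sum_le_sum fun n _ => ?_
    have h3 : 0 ≤ betaCoeff k (n + 2) := by unfold betaCoeff; positivity
    rw [abs_mul, abs_of_nonneg h3, mul_div_assoc]
    exact mul_le_mul_of_nonneg_left (betaCoeff_le hk n) (abs_nonneg _)
  have h4 : (3 * k + 2) / ((k : ℝ) ^ 2 * ((k + 1) * (k + 2))) ≤ 3 / (k : ℝ) ^ 3 := by
    rw [div_le_div_iff₀ (by positivity) (by positivity)]
    have : 0 ≤ (k : ℝ) ^ 2 * (7 * k + 6) := by positivity
    nlinarith
  have h5 : (0 : ℝ) ≤ i * (i + 1) := by positivity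
  rw [h1, add_div (3 * ((i : ℝ) * (i + 1)))]
  refine (abs_sub _ _).trans (add_le_add ?_ h2)
  rw [abs_neg, abs_of_nonneg (by positivity)]
  calc _ ≤ (i * (i + 1) : ℝ) * (3 / (k : ℝ) ^ 3) := mul_le_mul_of_nonneg_left h4 h5
    _ = _ := by ring

end BalancedP1

end

theorem proposition7p3 :
    (∀ k : ℕ, 1 ≤ k → ∃ s : BalancedP1.SectionBasis k,
      (∀ j : Fin (k + 1), (s j : MvPolynomial (Fin 2) ℂ) =
        MvPolynomial.C ((Real.sqrt (k.choose j) : ℝ) : ℂ) *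
          MvPolynomial.X 0 ^ (j : ℕ) * MvPolynomial.X 1 ^ (k - j : ℕ)) ∧
      BalancedP1.IsBalanced s) ∧
    ∀ i : ℕ, ∃ K : ℝ, ∀ k : ℕ, 1 ≤ k → ∃ c : ℝ,
      |c - 4 * Real.pi * i * (i + 1) / (4 * Real.pi * (k : ℝ) ^ 2)| ≤ K / (k : ℝ) ^ 3 ∧
      ∀ s : BalancedP1.SectionBasis k, BalancedP1.IsBalanced s →
        (∀ A ∈ BalancedP1.U s i, ∀ B ∈ BalancedP1.U s i,
          ((A : Matrix (Fin (k + 1)) (Fin (k + 1)) ℂ) *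
              (BalancedP1.opPStarP s B : Matrix (Fin (k + 1)) (Fin (k + 1)) ℂ)).trace =
            (c : ℂ) * ((A : Matrix (Fin (k + 1)) (Fin (k + 1)) ℂ) *
              (B : Matrix (Fin (k + 1)) (Fin (k + 1)) ℂ)).trace) ∧
        ∀ B ∈ BalancedP1.U s i, BalancedP1.opPStarP s B = c • B := by
  refine ⟨fun k _ => ⟨BalancedP1.binomialBasis k, BalancedP1.binomialBasis_apply k,
    BalancedP1.isBalanced_binomialBasis k⟩, fun i => ?_⟩
  obtain ⟨K, hK⟩ := BalancedP1.exists_funkHecke_asymptotic i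
  refine ⟨K, fun k hk => ⟨_, hK k hk, fun s hs => ⟨fun A _ B hB => ?_, fun B hB =>
    hs.opPStarP_eq hB⟩⟩⟩
  rw [BalancedP1.trace_mul_opPStarP, hs.l2Inner_opP A hB]
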